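/- Let $n\ge 1$. Let $\mathcal{P}_n$ be the partition monoid: its elements are the equivalence relations on $\{1,\dots,n\}\cup\{1',\dots,n'\}$ (the classes are called blocks), drawn as diagrams with upper row $1,\dots,n$ and lower row $1',\dots,n'$. The product $\alpha\beta$ is obtained by stacking $\alpha$ on top of $\beta$, identifying the lower row of $\alpha$ with the upper row of $\beta$, and restricting connectedness in the resulting graph to the two outer rows; the identity $1$ has blocks $\{k,k'\}$. The rank of $\alpha$ is the number of its blocks that meet both rows, and $\alpha^*$ is the reflection of $\alpha$ in a horizontal axis. The Jones monoid $\mathcal{J}_n\subseteq\mathcal{P}_n$ consists of the partitions all of whose blocks have size $2$ and which can be drawn without crossings. For $1\le i\le n-1$ let $\tau_i\in\mathcal{J}_n$ have blocks $\{i,i+1\}$, $\{i',(i+1)'\}$ and $\{k,k'\}$ for all other $k$. For $1\le i\le n-2$ let $\lambda_i$ have blocks $\{i,i+1\}$, $\{i+2,i'\}$, $\{(i+1)',(i+2)'\}$ and $\{k,k'\}$ for all other $k$, and let $\rho_i=\lambda_i^*$. Let $E_n$ be the set of idempotents of $\mathcal{J}_n$ of rank $n-2$. (In fact $E_n=\{\tau_1,\dots,\tau_{n-1}\}\cup\{\lambda_1,\dots,\lambda_{n-2}\}\cup\{\rho_1,\dots,\rho_{n-2}\}$.)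 For $F\subseteq E_n$ let $\Xi_n(F)$ be the following digraph with red and blue arcs. Its vertices are the projections of rank $n-2$ in $\mathcal{J}_n$, i.e. the $p\in E_n$ with $p^*=p$ (these are $\tau_1,\dots,\tau_{n-1}$). There is a blue arc $p\to q$ whenever $pq$ has rank $n-2$ (for $\tau_i\to\tau_j$ this means $|i-j|\le 1$). There is a red arc $\tau_i\to\tau_i$ if $\tau_i\in F$, a red arc $\tau_i\to\tau_{i+1}$ if $\lambda_i\in F$, and a red arc $\tau_{i+1}\to\tau_i$ if $\rho_i\in F$. An RBR-alternating circuit based at a vertex $v$ is a directed path from $v$ to $v$ (vertices and arcs may be repeated) whose arcs alternate in colour between red and blue and whose first and last arcs are red; a single red loop is an example. A red circuit is a directed closed path with at least one arc, all of whose arcs are red. **Theorem.** For every $F\subseteq E_n$ the following are equivalent: (i) $\mathcal{J}_n\setminus\{1\}=\langle F\rangle$, the semigroup generated by $F$; (ii) each vertex of $\Xi_n(F)$ is the base point of an RBR-alternating circuit; (iii) each vertex of $\Xi_n(F)$ is contained in a red circuit. Moreover, the number $f_n$ of subsets $F\subseteq E_n$ with these properties satisfies $$f_2=1,\qquad f_3=7,\qquad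 f_n=5f_{n-1}+6f_{n-2}\quad\text{for all } n\ge 4.$$ -/

import Mathlib

/-- The vertices of a diagram on `n` strings: the upper row `1, …, n` (`Sum.inl`) and
the lower row `1', …, n'` (`Sum.inr`).  Positions are numbered from `0`. -/
abbrev DiagramVertex (n : ℕ) : Type := Fin n ⊕ Fin n

/-- An element of the partition monoid `𝒫ₙ`: an equivalence relation on the `2n` vertices. -/
@[ext]
structure PartitionDiagram (n : ℕ) where
  /-- the equivalence relation whose classes are the blocks -/
  rel : Setoid (DiagramVertex n)

namespace PartitionDiagram

variable {n : ℕ}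

/-- The partition represented by a graph: its blocks are the connected components. -/
def ofGraph (edge : DiagramVertex n → DiagramVertex n → Prop) : PartitionDiagram n :=
  ⟨Relation.EqvGen.setoid edge⟩

/-- Edges of the identity diagram: `k — k'` for all `k`. -/
def oneEdge : DiagramVertex n → DiagramVertex n → Prop
  | .inl a, .inr b => a = b
  | _, _ => False

instance : One (PartitionDiagram n) := ⟨ofGraph oneEdge⟩

/-- The three rows of the stacked diagrams `α` (above) and `β` (below). -/
inductive StackVertex (n : ℕ) : Type
  | top (k : Fin n)
  | mid (k : Fin n)
  | bot (k : Fin n)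

/-- Placement of the vertices of the upper diagram in the stack. -/
def upperPlace : DiagramVertex n → StackVertex n
  | .inl k => .top k
  | .inr k => .mid k

/-- Placement of the vertices of the lower diagram in the stack. -/
def lowerPlace : DiagramVertex n → StackVertex n
  | .inl k => .mid k
  | .inr k => .bot k

/-- Placement of the vertices of the product: the outer two rows of the stack. -/
def outerPlace : DiagramVertex n → StackVertex n
  | .inl k => .top k
  | .inr k => .bot k

/-- The graph got by stacking `α` on `β`, identifying the lower row of `α` with the
upper row of `β`. -/
inductive StackEdge (α β : PartitionDiagram n) : StackVertex n → StackVertex n → Prop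
  | upper {x y : DiagramVertex n} (h : α.rel x y) :
      StackEdge α β (upperPlace x) (upperPlace y)
  | lower {x y : DiagramVertex n} (h : β.rel x y) :
      StackEdge α β (lowerPlace x) (lowerPlace y)

/-- The product `αβ`: connectedness in the stacked graph, restricted to the outer rows. -/
instance : Mul (PartitionDiagram n) :=
  ⟨fun α β => ⟨Setoid.comap outerPlace (Relation.EqvGen.setoid (StackEdge α β))⟩⟩

/-- The involution `α ↦ α*`: reflection in a horizontal axis. -/
instance : Star (PartitionDiagram n) := ⟨fun α => ⟨Setoid.comap Sum.swap α.rel⟩⟩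

/-- The rank: the number of blocks that meet both rows. -/
noncomputable def rank (α : PartitionDiagram n) : ℕ :=
  {B ∈ α.rel.classes | (∃ i, Sum.inl i ∈ B) ∧ ∃ j, Sum.inr j ∈ B}.ncard

/-- Every block has exactly two elements. -/
def IsBrauer (α : PartitionDiagram n) : Prop := ∀ B ∈ α.rel.classes, B.ncard = 2

/-- Position of a vertex in the order `1, 2, …, n, n', …, 2', 1'` around the boundary
of the diagram. -/
def boundaryPos : DiagramVertex n → ℕ
  | .inl k => k
  | .inr k => 2 * n - 1 - k

/-- The partition can be drawn without crossings inside the rectangle bounded by the two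
rows: two blocks never interleave along the boundary. -/
def IsPlanar (α : PartitionDiagram n) : Prop :=
  ∀ a b c d : DiagramVertex n, boundaryPos a < boundaryPos b → boundaryPos b < boundaryPos c →
    boundaryPos c < boundaryPos d → α.rel a c → α.rel b d → α.rel a b

/-- The Jones monoid `𝒥ₙ`, as a subset of the partition monoid. -/
def jones (n : ℕ) : Set (PartitionDiagram n) := {α | IsBrauer α ∧ IsPlanar α}

/-- The idempotents of rank `n - 2` in `𝒥ₙ`. -/
def subtopIdempotents (n : ℕ) : Set (PartitionDiagram n) :=
  {α | α ∈ jones n ∧ IsIdempotentElem α ∧ α.rank + 2 = n}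

/-- Edges of `τᵢ` (with `i` counted from `0`). -/
def tauEdge (i : ℕ) : DiagramVertex n → DiagramVertex n → Prop
  | .inl a, .inl b => a.val = i ∧ b.val = i + 1
  | .inr a, .inr b => a.val = i ∧ b.val = i + 1
  | .inl a, .inr b => a = b ∧ a.val ≠ i ∧ a.val ≠ i + 1
  | .inr _, .inl _ => False

/-- `τᵢ` has blocks `{i, i+1}`, `{i', (i+1)'}` and `{k, k'}` for all other `k`. -/
def tau (n i : ℕ) : PartitionDiagram n := ofGraph (tauEdge i)

/-- Edges of `λᵢ` (with `i` counted from `0`). -/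
def lamEdge (i : ℕ) : DiagramVertex n → DiagramVertex n → Prop
  | .inl a, .inl b => a.val = i ∧ b.val = i + 1
  | .inr a, .inr b => a.val = i + 1 ∧ b.val = i + 2
  | .inl a, .inr b => (a.val = i + 2 ∧ b.val = i) ∨
      (a = b ∧ a.val ≠ i ∧ a.val ≠ i + 1 ∧ a.val ≠ i + 2)
  | .inr _, .inl _ => False

/-- `λᵢ` has blocks `{i, i+1}`, `{i+2, i'}`, `{(i+1)', (i+2)'}` and `{k, k'}` for all
other `k`. -/
def lam (n i : ℕ) : PartitionDiagram n := ofGraph (lamEdge i)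

/-- Edges of `ρᵢ` (with `i` counted from `0`). -/
def rhoEdge (i : ℕ) : DiagramVertex n → DiagramVertex n → Prop
  | .inl a, .inl b => a.val = i + 1 ∧ b.val = i + 2
  | .inr a, .inr b => a.val = i ∧ b.val = i + 1
  | .inl a, .inr b => (a.val = i ∧ b.val = i + 2) ∨
      (a = b ∧ a.val ≠ i ∧ a.val ≠ i + 1 ∧ a.val ≠ i + 2)
  | .inr _, .inl _ => False

/-- `ρᵢ` has blocks `{i+1, i+2}`, `{i, (i+2)'}`, `{i', (i+1)'}` and `{k, k'}` for all
other `k`. -/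
def rho (n i : ℕ) : PartitionDiagram n := ofGraph (rhoEdge i)

/-- The set `F` generates the singular part of `𝒥ₙ` as a semigroup: `𝒥ₙ ∖ {1} = ⟨F⟩`. -/
def GeneratesSingularJones (F : Set (PartitionDiagram n)) : Prop :=
  (Subsemigroup.closure F : Set (PartitionDiagram n)) = jones n \ {1}

end PartitionDiagram

/-- A digraph (loops allowed) with red and blue arcs; there may be both a red and a blue
arc from one vertex to another. -/
structure TwoColouredDigraph (V : Type*) where
  /-- the red arcs -/
  red : V → V → Prop
  /-- the blue arcs -/
  blue : V → V → Prop

namespace TwoColouredDigraph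

variable {V : Type*}

/-- There is a directed path from `u` to `v` whose arcs are alternately red and blue and
whose first and last arcs are red. -/
inductive RBRPath (G : TwoColouredDigraph V) : V → V → Prop
  | single {u v : V} (h : G.red u v) : RBRPath G u v
  | cons {u v w x : V} (h : G.red u v) (h' : G.blue v w) (p : RBRPath G w x) : RBRPath G u x

/-- `v` is the base point of an RBR-alternating circuit. -/
def IsRBRBase (G : TwoColouredDigraph V) (v : V) : Prop := G.RBRPath v v

/-- `v` is one of the vertices of a directed circuit all of whose arcs are red. -/
def OnRedCircuit (G : TwoColouredDigraph V) (v : V) : Prop :=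
  ∃ c : Cycle V, v ∈ c ∧ c.Chain G.red

end TwoColouredDigraph

namespace PartitionDiagram

variable {n : ℕ}

/-- The vertices of the graph `Ξₙ`: the projections of rank `n - 2` in `𝒥ₙ`. -/
def XiVertex (n : ℕ) : Type := {p : PartitionDiagram n // p ∈ subtopIdempotents n ∧ star p = p}

/-- The two-coloured digraph `Ξₙ(F)`.  Its blue arcs are those of the projection graph `Ξₙ`
(the product of the two projections is nonzero in the principal factor of the elements of
rank `n - 2`), and its red arcs are those given by the elements of `F`. -/
def Xi (n : ℕ) (F : Set (PartitionDiagram n)) : TwoColouredDigraph (XiVertex n) where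
  blue p q := (p.1 * q.1).rank + 2 = n
  red p q :=
    (∃ i, i + 1 < n ∧ tau n i ∈ F ∧ p.1 = tau n i ∧ q.1 = tau n i) ∨
    (∃ i, i + 2 < n ∧ lam n i ∈ F ∧ p.1 = tau n i ∧ q.1 = tau n (i + 1)) ∨
    (∃ i, i + 2 < n ∧ rho n i ∈ F ∧ p.1 = tau n (i + 1) ∧ q.1 = tau n i)

/-- `fₙ`: the number of sets of idempotents of rank `n - 2` that generate `𝒥ₙ ∖ {1}`. -/
noncomputable def numGeneratingSets (n : ℕ) : ℕ :=
  {F : Set (PartitionDiagram n) | F ⊆ subtopIdempotents n ∧ GeneratesSingularJones F}.ncard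

end PartitionDiagram

namespace PartitionDiagram

variable {n : ℕ}

/-! The proof reduces `𝒥ₙ` to its elements of rank `n - 2`. Each of these is determined by its upper
hook `k` and lower hook `l`, and is written `hookProd n k l`. The product of `(i, j)` and `(k, l)`
is `(i, l)` when `|j - k| ≤ 1` and has smaller rank otherwise (`hookProd_mul_hookProd`,
`rank_tau_mul_hookProd_lt`). The idempotents among them are those with `|k - l| ≤ 1`, that is, the
possible red arcs, and blue arcs record which products keep the rank.

Every element of `𝒥ₙ` other than `1` is a product of the `τᵢ` (`jones_induction`), so `F` generates
exactly when it yields every `τᵢ`. A product of elements of `F` that keeps rank `n - 2` is an RBR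
path from its upper to its lower hook, so this means an RBR circuit at every vertex.

All arcs join indices at distance at most one on a line. If a vertex had neither a red loop nor a
pair of opposite red arcs to a neighbour, an RBR circuit would have to leave it on one side and
return from the other without ever being able to pass it. Hence all three conditions are equivalent
to `LocallyClosed`, which is local on a path, and the sets `F` are counted by a two-state transfer
matrix. -/

/-! ### Products in the partition monoid: reflection, associativity, rank. -/

theorem ext_rel {α β : PartitionDiagram n} (h : ∀ x y, α.rel x y ↔ β.rel x y) : α = β :=
  PartitionDiagram.ext (Setoid.ext h)

theorem star_rel (α : PartitionDiagram n) (x y : DiagramVertex n) :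
    (star α).rel x y ↔ α.rel x.swap y.swap := Iff.rfl

/-- A labelling of the stack that is constant along the edges is constant on components. -/
theorem label_eq_of_eqvGen {T : Type*} {α β : PartitionDiagram n} (φ : StackVertex n → T)
    (hu : ∀ x y, α.rel x y → φ (upperPlace x) = φ (upperPlace y))
    (hl : ∀ x y, β.rel x y → φ (lowerPlace x) = φ (lowerPlace y)) {u v : StackVertex n}
    (h : Relation.EqvGen (StackEdge α β) u v) : φ u = φ v := by
  induction h with
  | rel u v h =>
    cases h with
    | upper h => exact hu _ _ h
    | lower h => exact hl _ _ h
  | refl => rfl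
  | symm _ _ _ ih => exact ih.symm
  | trans _ _ _ _ _ ih₁ ih₂ => exact ih₁.trans ih₂

theorem upper_eqvGen {α : PartitionDiagram n} (β : PartitionDiagram n) {x y : DiagramVertex n}
    (h : α.rel x y) : Relation.EqvGen (StackEdge α β) (upperPlace x) (upperPlace y) :=
  .rel _ _ (.upper h)

theorem lower_eqvGen (α : PartitionDiagram n) {β : PartitionDiagram n} {x y : DiagramVertex n}
    (h : β.rel x y) : Relation.EqvGen (StackEdge α β) (lowerPlace x) (lowerPlace y) :=
  .rel _ _ (.lower h)

theorem mul_rel_inl {α : PartitionDiagram n} (β : PartitionDiagram n) {a b : Fin n}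
    (h : α.rel (.inl a) (.inl b)) : (α * β).rel (.inl a) (.inl b) :=
  upper_eqvGen β h

theorem mul_rel_inr (α : PartitionDiagram n) {β : PartitionDiagram n} {a b : Fin n}
    (h : β.rel (.inr a) (.inr b)) : (α * β).rel (.inr a) (.inr b) :=
  lower_eqvGen α h

theorem star_star' (α : PartitionDiagram n) : star (star α) = α :=
  ext_rel fun x y => by simp [star_rel]

/-- Each stack vertex is labelled by the component of its mirror image. One inclusion is enough,
since reflecting it gives the other. -/
theorem star_mul_rel_of {α β : PartitionDiagram n} {x y : DiagramVertex n}
    (h : (star (α * β)).rel x y) : (star β * star α).rel x y := by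
  let flip : StackVertex n → StackVertex n
    | .top k => .bot k
    | .mid k => .mid k
    | .bot k => .top k
  have hu : ∀ z : DiagramVertex n, flip (upperPlace z) = lowerPlace z.swap := by
    rintro (k | k) <;> rfl
  have hl : ∀ z : DiagramVertex n, flip (lowerPlace z) = upperPlace z.swap := by
    rintro (k | k) <;> rfl
  have ho : ∀ z : DiagramVertex n, flip (outerPlace z.swap) = outerPlace z := by
    rintro (k | k) <;> rfl
  have key := label_eq_of_eqvGen
    (fun v => {w | Relation.EqvGen (StackEdge (star β) (star α)) (flip v) w}) ?_ ?_ h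
  · have hy : outerPlace y ∈ {w | Relation.EqvGen (StackEdge (star β) (star α))
        (flip (outerPlace y.swap)) w} := by rw [ho]; exact .refl _
    rw [← key] at hy
    simp only [ho] at hy
    exact hy
  · intro a b hab
    ext w
    have : Relation.EqvGen (StackEdge (star β) (star α)) (flip (upperPlace a))
        (flip (upperPlace b)) := by
      rw [hu, hu]; exact lower_eqvGen _ (by simpa [star_rel] using hab)
    exact ⟨fun h => (this.symm).trans _ _ _ h, fun h => this.trans _ _ _ h⟩
  · intro a b hab
    ext w
    have : Relation.EqvGen (StackEdge (star β) (star α)) (flip (lowerPlace a))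
        (flip (lowerPlace b)) := by
      rw [hl, hl]; exact upper_eqvGen _ (by simpa [star_rel] using hab)
    exact ⟨fun h => (this.symm).trans _ _ _ h, fun h => this.trans _ _ _ h⟩

theorem star_mul' (α β : PartitionDiagram n) : star (α * β) = star β * star α := by
  refine ext_rel fun x y => ⟨star_mul_rel_of, fun h => ?_⟩
  have h' : (star (star β * star α)).rel x.swap y.swap := by simpa [star_rel] using h
  have h'' := star_mul_rel_of h'
  rwa [star_star', star_star'] at h''

/-- `C` is the component in the stack of `α` on `βγ`. `L` transports it into the stack of `β` on
`γ`, being empty on components that miss the outer rows. The labellings `ψ` of `α` on `β` and `φ` of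
`αβ` on `γ` glue the two. The converse again follows by reflection. -/
theorem mul_assoc_rel_of {α β γ : PartitionDiagram n} {x y : DiagramVertex n}
    (h : (α * β * γ).rel x y) : (α * (β * γ)).rel x y := by
  let C : StackVertex n → Set (StackVertex n) := fun v =>
    {w | Relation.EqvGen (StackEdge α (β * γ)) v w}
  have hC : ∀ {u v}, Relation.EqvGen (StackEdge α (β * γ)) u v → C u = C v := fun h =>
    Set.ext fun w => ⟨fun h' => h.symm.trans _ _ _ h', fun h' => h.trans _ _ _ h'⟩
  let L : StackVertex n → Set (StackVertex n) := fun v =>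
    {w | ∃ o, Relation.EqvGen (StackEdge β γ) v (outerPlace o) ∧ w ∈ C (lowerPlace o)}
  have hL : ∀ {u v}, Relation.EqvGen (StackEdge β γ) u v → L u = L v := fun h =>
    Set.ext fun w => ⟨fun ⟨o, h', hw⟩ => ⟨o, h.symm.trans _ _ _ h', hw⟩,
      fun ⟨o, h', hw⟩ => ⟨o, h.trans _ _ _ h', hw⟩⟩
  have hLo : ∀ o, L (outerPlace o) = C (lowerPlace o) := fun o =>
    Set.ext fun w => ⟨fun ⟨o', h', hw⟩ => (hC (lower_eqvGen α (β := β * γ) h')) ▸ hw,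
      fun hw => ⟨o, .refl _, hw⟩⟩
  let ψ : StackVertex n → Set (StackVertex n)
    | .top k => C (.top k)
    | .mid k => C (.mid k)
    | .bot k => L (.mid k)
  let φ : StackVertex n → Set (StackVertex n)
    | .top k => C (.top k)
    | .mid k => L (.mid k)
    | .bot k => L (.bot k)
  have hφl : ∀ z, φ (lowerPlace z) = L (lowerPlace z) := by rintro (k | k) <;> rfl
  have hφo : ∀ z, φ (outerPlace z) = C (outerPlace z) := by
    rintro (k | k)
    · rfl
    · exact hLo (.inr k)
  have hφu : ∀ z, φ (upperPlace z) = ψ (outerPlace z) := by rintro (k | k) <;> rfl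
  have hψu : ∀ z, ψ (upperPlace z) = C (upperPlace z) := by rintro (k | k) <;> rfl
  have hψl : ∀ z, ψ (lowerPlace z) = L (upperPlace z) := by
    rintro (k | k)
    · exact (hLo (.inl k)).symm
    · rfl
  have key : φ (outerPlace x) = φ (outerPlace y) := by
    refine label_eq_of_eqvGen φ (fun a b hab => ?_) (fun a b hab => ?_) h
    · rw [hφu, hφu]
      refine label_eq_of_eqvGen ψ (fun a b hab => ?_) (fun a b hab => ?_) hab
      · rw [hψu, hψu]; exact hC (upper_eqvGen _ hab)
      · rw [hψl, hψl]; exact hL (upper_eqvGen _ hab)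
    · rw [hφl, hφl]; exact hL (lower_eqvGen _ hab)
  rw [hφo, hφo] at key
  have hy : outerPlace y ∈ C (outerPlace y) := .refl _
  rw [← key] at hy
  exact hy

theorem mul_assoc' (α β γ : PartitionDiagram n) : α * β * γ = α * (β * γ) := by
  refine ext_rel fun x y => ⟨mul_assoc_rel_of, fun h => ?_⟩
  have h' : (star (α * (β * γ))).rel x.swap y.swap := by simpa [star_rel] using h
  rw [star_mul', star_mul'] at h'
  have h'' := mul_assoc_rel_of h'
  rw [← star_mul', ← star_mul'] at h''
  simpa [star_rel] using h''

theorem rank_mul_le (α β : PartitionDiagram n) : (α * β).rank ≤ β.rank := by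
  have hex : ∀ i j, (α * β).rel (.inl i) (.inr j) → ∃ k, β.rel (.inl k) (.inr j) := by
    intro i j h
    by_contra! hno
    let φ : StackVertex n → Prop
      | .bot k => β.rel (.inr k) (.inr j)
      | _ => False
    have key : φ (outerPlace (.inl i)) = φ (outerPlace (.inr j)) := by
      refine label_eq_of_eqvGen φ (fun a b hab => ?_) (fun a b hab => ?_) h
      · rcases a with a | a <;> rcases b with b | b <;> rfl
      · have := fun k => β.rel.trans' hab (z := k)
        have := fun k => β.rel.trans' (β.rel.symm' hab) (z := k)
        rcases a with a | a <;> rcases b with b | b <;> simp only [φ, lowerPlace, eq_iff_iff] <;>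
          grind
    exact key.mpr (β.rel.refl' _)
  rcases isEmpty_or_nonempty (Fin n) with hn | hn
  · simp [rank]
  choose! f hf using fun (B : Set (DiagramVertex n))
    (hB : B ∈ {B ∈ (α * β).rel.classes | (∃ i, Sum.inl i ∈ B) ∧ ∃ j, Sum.inr j ∈ B}) => hB.2.2
  -- A block of the product meeting both rows is sent to the `β`-block of one of its lower vertices;
  -- this is injective because lower connections of `β` survive in the product.
  refine Set.ncard_le_ncard_of_injOn (fun B => {x | β.rel x (.inr (f B))}) ?_ ?_ (Set.toFinite _)
  · intro B hB
    have hfB := hf B hB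
    obtain ⟨⟨y, rfl⟩, ⟨i, hi⟩, -⟩ := hB
    obtain ⟨k, hk⟩ := hex i _ ((α * β).rel.trans' hi ((α * β).rel.symm' hfB))
    exact ⟨⟨_, rfl⟩, ⟨k, hk⟩, ⟨_, β.rel.refl' _⟩⟩
  · intro B hB B' hB' hBB
    have hfB := hf B hB
    have hfB' := hf B' hB'
    have h1 : β.rel (.inr (f B)) (.inr (f B')) := by
      have : (.inr (f B) : DiagramVertex n) ∈ {x | β.rel x (.inr (f B))} := β.rel.refl' _
      simp only at hBB
      rw [hBB] at this
      exact this
    have h2 := mul_rel_inr α h1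
    exact Setoid.eq_of_mem_classes hB.1 hfB hB'.1 (by
      obtain ⟨⟨y, rfl⟩, -⟩ := hB'
      exact (α * β).rel.trans' h2 hfB')

/-! ### Brauer diagrams as matchings, and left multiplication by `τᵢ`. -/

/-- A fixed-point-free involution of the vertices. -/
structure IsMatching (σ : DiagramVertex n → DiagramVertex n) : Prop where
  ne : ∀ x, σ x ≠ x
  invol : ∀ x, σ (σ x) = x

/-- The blocks of `α` are the pairs `{x, σ x}`. -/
structure Represents (σ : DiagramVertex n → DiagramVertex n) (α : PartitionDiagram n) : Prop
    extends IsMatching σ where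
  rel_iff : ∀ x y, α.rel x y ↔ y = x ∨ y = σ x

theorem Represents.eq {σ : DiagramVertex n → DiagramVertex n} {α β : PartitionDiagram n}
    (hα : Represents σ α) (hβ : Represents σ β) : α = β :=
  ext_rel fun x y => by rw [hα.rel_iff, hβ.rel_iff]

theorem Represents.rel_apply {σ : DiagramVertex n → DiagramVertex n} {α : PartitionDiagram n}
    (h : Represents σ α) (x : DiagramVertex n) : α.rel x (σ x) :=
  (h.rel_iff _ _).2 (.inr rfl)

theorem Represents.apply_eq {σ : DiagramVertex n → DiagramVertex n} {α : PartitionDiagram n}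
    (h : Represents σ α) {x y : DiagramVertex n} (hxy : α.rel x y) (hne : y ≠ x) : σ x = y :=
  (((h.rel_iff _ _).1 hxy).resolve_left hne).symm

theorem Represents.isBrauer {σ : DiagramVertex n → DiagramVertex n} {α : PartitionDiagram n}
    (h : Represents σ α) : α.IsBrauer := by
  rintro B ⟨y, rfl⟩
  have : {x | α.rel x y} = {y, σ y} := by
    ext x
    rw [Set.mem_ofPred_eq, α.rel.comm', h.rel_iff]
    rfl
  rw [this]
  exact Set.ncard_pair (h.ne y).symm

theorem IsBrauer.exists_represents {α : PartitionDiagram n} (h : α.IsBrauer) :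
    ∃ σ, Represents σ α := by
  have hex : ∀ x, ∃ y, y ≠ x ∧ ∀ z, α.rel x z ↔ z = x ∨ z = y := by
    intro x
    obtain ⟨u, v, huv, hB⟩ := Set.ncard_eq_two.1 (h {z | α.rel z x} ⟨x, rfl⟩)
    have hz : ∀ z, α.rel x z ↔ z = u ∨ z = v := fun z => by
      rw [α.rel.comm']
      exact Set.ext_iff.1 hB z
    rcases (hz x).1 (α.rel.refl' x) with rfl | rfl
    · exact ⟨v, huv.symm, hz⟩
    · exact ⟨u, huv, fun z => (hz z).trans or_comm⟩
  choose σ hne hσ using hex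
  refine ⟨σ, ⟨hne, fun x => ?_⟩, hσ⟩
  have h1 : α.rel x (σ x) := (hσ _ _).2 (.inr rfl)
  exact (((hσ _ _).1 (α.rel.symm' h1)).resolve_left (hne x).symm).symm

theorem represents_ofGraph {σ : DiagramVertex n → DiagramVertex n}
    {e : DiagramVertex n → DiagramVertex n → Prop} (hσ : IsMatching σ)
    (h₁ : ∀ x y, e x y → σ x = y) (h₂ : ∀ x, e x (σ x) ∨ e (σ x) x) :
    Represents σ (ofGraph e) := by
  refine ⟨hσ, fun x y => ⟨fun h => ?_, ?_⟩⟩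
  · induction (h : Relation.EqvGen e x y) with
    | rel x y h => exact .inr (h₁ _ _ h).symm
    | refl => exact .inl rfl
    | symm x y h ih =>
      rcases ih with rfl | rfl
      · exact .inl rfl
      · exact .inr (hσ.invol x).symm
    | trans x y z h h' ih ih' =>
      have := hσ.invol x
      rcases ih with rfl | rfl <;> rcases ih' with rfl | rfl <;> simp_all
  · rintro (rfl | rfl)
    · exact (ofGraph e).rel.refl' _
    · rcases h₂ x with h | h
      · exact Relation.EqvGen.rel _ _ h
      · exact (Relation.EqvGen.rel _ _ h).symm

theorem represents_one : Represents Sum.swap (1 : PartitionDiagram n) := by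
  refine represents_ofGraph ⟨?_, fun x => Sum.swap_swap x⟩ ?_ ?_
  · rintro (x | x) <;> simp
  · rintro (x | x) (y | y) h <;> simp_all [oneEdge]
  · rintro (x | x) <;> simp [oneEdge]

/-- The matching in which `p` is joined to `q` and the partners of `p` and `q` are joined. -/
def reconnect (p q : DiagramVertex n) (σ : DiagramVertex n → DiagramVertex n)
    (x : DiagramVertex n) : DiagramVertex n :=
  if x = p then q else if x = q then p else if x = σ p then σ q else if x = σ q then σ p else σ x

theorem IsMatching.reconnect {σ : DiagramVertex n → DiagramVertex n} (h : IsMatching σ)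
    {p q : DiagramVertex n} (hpq : p ≠ q) : IsMatching (reconnect p q σ) := by
  obtain ⟨h1, h2⟩ := h
  have := h1 p
  have := h1 q
  have := h2 p
  have := h2 q
  refine ⟨fun x => ?_, fun x => ?_⟩
  · have := h1 x
    have := h2 x
    simp only [PartitionDiagram.reconnect]
    grind
  · have := h1 x
    have := h2 x
    simp only [PartitionDiagram.reconnect]
    grind

theorem reconnect_eq_self {σ : DiagramVertex n → DiagramVertex n} (h : IsMatching σ)
    {p q : DiagramVertex n} (hpq : σ p = q) : reconnect p q σ = σ := by
  obtain ⟨h1, h2⟩ := h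
  have := h2 p
  funext x
  simp only [reconnect]
  grind

theorem reconnect_comm {σ : DiagramVertex n → DiagramVertex n} (h : IsMatching σ)
    (p q : DiagramVertex n) : reconnect p q σ = reconnect q p σ := by
  obtain ⟨h1, h2⟩ := h
  have := h2 p
  have := h2 q
  funext x
  simp only [reconnect]
  grind

theorem reconnect_reconnect {σ : DiagramVertex n → DiagramVertex n} (h : IsMatching σ)
    {p q r : DiagramVertex n} (hpq : σ p = q) (hq : r ≠ q) :
    reconnect p q (reconnect p r σ) = σ := by
  obtain ⟨h1, h2⟩ := h
  have := h1 p
  have := h2 p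
  have := h1 r
  have := h2 r
  funext x
  have := h2 x
  simp only [reconnect]
  grind

theorem represents_tau {a b : Fin n} (hab : b.val = a.val + 1) :
    Represents (reconnect (.inl a) (.inl b) Sum.swap) (tau n a) := by
  have hne : a ≠ b := by rintro rfl; omega
  refine represents_ofGraph (represents_one.toIsMatching.reconnect (by simpa using hne)) ?_ ?_
  · rintro (x | x) (y | y) h <;> simp only [tauEdge, reconnect] at h ⊢ <;> grind [Sum.swap]
  · rintro (x | x) <;> simp only [tauEdge, reconnect] <;> grind [Sum.swap, tauEdge]

/-- Turns products with `τ` into explicit operations on involutions: the hook of `τ` caps `a` and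
`b`, while its lower hook links their former partners. -/
theorem Represents.tau_mul {σ : DiagramVertex n → DiagramVertex n} {α : PartitionDiagram n}
    (h : Represents σ α) {a b : Fin n} (hab : b.val = a.val + 1) :
    Represents (reconnect (.inl a) (.inl b) σ) (tau n a * α) := by
  have hne : a ≠ b := by rintro rfl; omega
  have hne' : (.inl a : DiagramVertex n) ≠ .inl b := by simpa using hne
  have ht := represents_tau hab
  have hm := h.toIsMatching.reconnect hne'
  refine ⟨hm, fun x y => ⟨fun hxy => ?_, ?_⟩⟩
  · set σ' := reconnect (.inl a) (.inl b) σ with hσ'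
    let c : DiagramVertex n → Set (DiagramVertex n) := fun x => {x, σ' x}
    have hc : ∀ x, c (σ' x) = c x := fun x => by
      simp only [c, hm.invol]
      exact Set.pair_comm _ _
    have hcmem : ∀ x y, y ∈ c x ↔ y = x ∨ y = σ' x := fun x y => Iff.rfl
    clear_value c
    have i1 := h.invol (.inl a)
    have i2 := h.invol (.inl b)
    have hcab : c (.inl b) = c (.inl a) := by
      rw [← hc (.inl a)]; simp [hσ', reconnect]
    -- Labels each stack vertex by the claimed chord passing through it. The middle vertices `a` and
    -- `b` lie on the chord of `σ a`; if `σ a = b` they form a detached loop and the label is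
    -- immaterial.
    let φ : StackVertex n → Set (DiagramVertex n)
      | .top k => c (.inl k)
      | .mid k => if k = a ∨ k = b then c (σ (.inl a)) else c (.inl k)
      | .bot k => c (.inr k)
    have hφl : ∀ x, φ (lowerPlace x) = if x = .inl a ∨ x = .inl b then c (σ (.inl a)) else c x := by
      rintro (k | k) <;> simp [φ, lowerPlace]
    have key : φ (outerPlace x) = φ (outerPlace y) := by
      refine label_eq_of_eqvGen φ (fun u v huv => ?_) (fun u v huv => ?_) hxy
      · rcases (ht.rel_iff _ _).1 huv with rfl | rfl
        · rfl
        · rcases u with k | k <;> by_cases hka : k = a <;> by_cases hkb : k = b <;>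
            simp [reconnect, hka, hkb, φ, upperPlace, hcab, hne, hne.symm]
      · rcases (h.rel_iff _ _).1 huv with rfl | rfl
        · rfl
        · have h0 : σ (.inl a) ≠ .inl b → c (σ (.inl b)) = c (σ (.inl a)) := fun h' => by
            rw [← hc (σ (.inl a))]
            have := h.ne (.inl a)
            congr 1
            simp only [hσ', reconnect]
            grind
          have h1 : u ≠ .inl a → u ≠ .inl b → σ u ≠ .inl a → σ u ≠ .inl b → c (σ u) = c u :=
            fun h1 h2 h3 h4 => by
              rw [← hc u]
              congr 1
              have := h.invol u
              simp only [hσ', reconnect]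
              grind
          have := h.invol u
          rw [hφl, hφl]
          clear hc hcmem hcab hφl
          clear_value φ σ'
          split_ifs with hu hv hv
          · rfl
          · rcases hu with rfl | rfl
            · rfl
            · exact (h0 (by grind)).symm
          · rcases hv with hv | hv <;> grind
          · grind
    have ho : ∀ x, φ (outerPlace x) = c x := by rintro (k | k) <;> rfl
    rw [ho, ho] at key
    exact (hcmem _ _).1 (key ▸ (hcmem y y).2 (.inl rfl))
  · have hmid : ∀ x : DiagramVertex n, x ≠ .inl a → x ≠ .inl b →
        Relation.EqvGen (StackEdge (tau n a) α) (outerPlace x) (lowerPlace x) := by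
      rintro (k | k) hka hkb
      · refine upper_eqvGen α (x := .inl k) (y := .inr k) ?_
        rw [ht.rel_iff]
        simp_all [reconnect]
      · exact .refl _
    have hap : ∀ x, σ x ≠ .inl a → σ x ≠ .inl b → x ≠ .inl a → x ≠ .inl b →
        (tau n a * α).rel x (σ x) := fun x h1 h2 h3 h4 =>
      ((hmid _ h3 h4).trans _ _ _ (lower_eqvGen _ (h.rel_apply x))).trans _ _ _ (hmid _ h1 h2).symm
    have hab1 : (tau n a * α).rel (.inl a) (.inl b) := by
      apply mul_rel_inl
      rw [ht.rel_iff]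
      simp [reconnect]
    have hab2 : Relation.EqvGen (StackEdge (tau n a) α) (lowerPlace (.inl a))
        (lowerPlace (.inl b)) := by
      refine upper_eqvGen α (x := .inr a) (y := .inr b) ?_
      rw [ht.rel_iff]
      simp [reconnect]
    have hσab : σ (.inl a) ≠ .inl b → (tau n a * α).rel (σ (.inl a)) (σ (.inl b)) := fun h' => by
      have h1 := h.ne (.inl a)
      have h2 := h.ne (.inl b)
      have h3 : σ (.inl b) ≠ .inl a := fun h3 => h' (by rw [← h3, h.invol])
      have e1 := (hmid _ h1 h').trans _ _ _ (lower_eqvGen _ (h.rel_apply (.inl a))).symm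
      have e2 := (hmid _ h3 h2).trans _ _ _ (lower_eqvGen _ (h.rel_apply (.inl b))).symm
      exact (e1.trans _ _ _ hab2).trans _ _ _ e2.symm
    rintro (rfl | rfl)
    · exact (tau n a * α).rel.refl' _
    · have i1 := h.invol (.inl a)
      have i2 := h.invol (.inl b)
      have i3 := h.invol x
      simp only [reconnect]
      split_ifs with h1 h2 h3 h4
      · exact h1 ▸ hab1
      · exact h2 ▸ (tau n a * α).rel.symm' hab1
      · exact h3 ▸ hσab (by grind)
      · exact h4 ▸ (tau n a * α).rel.symm' (hσab (by grind))
      · exact hap x (by grind) (by grind) h1 h2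

theorem tau_mul_one {a b : Fin n} (hab : b.val = a.val + 1) : tau n a * 1 = tau n a :=
  (represents_one.tau_mul hab).eq (represents_tau hab)

/-! ### Planarity as noncrossing of chords. -/

theorem boundaryPos_injective : Function.Injective (boundaryPos (n := n)) := by
  rintro (x | x) (y | y) h <;> simp only [boundaryPos] at h
  · exact congrArg _ (Fin.ext h)
  · omega
  · omega
  · exact congrArg _ (Fin.ext (by omega))

/-- `z` lies strictly between `x` and `y` in the order along the boundary. -/
def Btw (x y z : DiagramVertex n) : Prop :=
  (boundaryPos x < boundaryPos z ∧ boundaryPos z < boundaryPos y) ∨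
    (boundaryPos y < boundaryPos z ∧ boundaryPos z < boundaryPos x)

/-- No two chords `{x, σ x}` cross. -/
def Noncrossing (σ : DiagramVertex n → DiagramVertex n) : Prop :=
  ∀ x z, z ≠ x → z ≠ σ x → Btw x (σ x) z → Btw x (σ x) (σ z)

theorem Represents.isPlanar_iff {σ : DiagramVertex n → DiagramVertex n} {α : PartitionDiagram n}
    (h : Represents σ α) : α.IsPlanar ↔ Noncrossing σ := by
  have inj : ∀ x y : DiagramVertex n, x ≠ y → boundaryPos x ≠ boundaryPos y := fun x y h h' =>
    h (boundaryPos_injective h')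
  constructor
  · intro hp x z hzx hzs hb
    have h1 := hp x z (σ x) (σ z)
    have h2 := hp (σ z) x z (σ x)
    have h3 := hp (σ x) z x (σ z)
    have h4 := hp (σ z) (σ x) z x
    have hx := h.rel_apply x
    have hx' := α.rel.symm' hx
    have hz := h.rel_apply z
    have hz' := α.rel.symm' hz
    have i1 := h.invol x
    have i2 := h.invol z
    have e1 := inj (σ z) x (by grind)
    have e2 := inj (σ z) (σ x) (by grind)
    have k1 : ¬ α.rel x z := by rw [h.rel_iff]; tauto
    have k2 : ¬ α.rel (σ z) x := fun h' => k1 (α.rel.symm' (α.rel.trans' hz h'))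
    have k3 : ¬ α.rel (σ x) z := fun h' => k1 (α.rel.trans' hx h')
    have k4 : ¬ α.rel (σ z) (σ x) := fun h' => k2 (α.rel.trans' h' hx')
    unfold Btw at hb ⊢
    grind
  · intro hn a b c d hab hbc hcd hac hbd
    have e1 : c = σ a := (h.apply_eq hac (by rintro rfl; omega)).symm
    have e2 : d = σ b := (h.apply_eq hbd (by rintro rfl; omega)).symm
    have := hn a b (by rintro rfl; omega) (by rintro rfl; rw [← e1] at *; omega)
    rw [← e1, ← e2] at this
    unfold Btw at this
    omega

theorem mem_jones_iff {α : PartitionDiagram n} :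
    α ∈ jones n ↔ ∃ σ, Represents σ α ∧ Noncrossing σ := by
  constructor
  · rintro ⟨hB, hP⟩
    obtain ⟨σ, hσ⟩ := hB.exists_represents
    exact ⟨σ, hσ, hσ.isPlanar_iff.1 hP⟩
  · rintro ⟨σ, hσ, hn⟩
    exact ⟨hσ.isBrauer, hσ.isPlanar_iff.2 hn⟩

/-- `hC` and `hB` say that the new chord `{p, q}` is crossed by no other. The second new chord `{σ
p, σ q}` then comes for free: modulo 2, lying between its ends is the sum of lying between the ends
of `{p, σ p}`, `{q, σ q}` and `{p, q}`. -/
theorem Noncrossing.reconnect {σ : DiagramVertex n → DiagramVertex n} (hn : Noncrossing σ)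
    (h : IsMatching σ) {p q : DiagramVertex n} (hpq : p ≠ q)
    (hC : Btw p q (σ p) ↔ Btw p q (σ q))
    (hB : ∀ z, z ≠ p → z ≠ q → z ≠ σ p → z ≠ σ q → Btw p q z → Btw p q (σ z)) :
    Noncrossing (reconnect p q σ) := by
  by_cases hσ : σ p = q
  · rwa [reconnect_eq_self h hσ]
  have inj : ∀ x y : DiagramVertex n, x ≠ y → boundaryPos x ≠ boundaryPos y := fun x y h h' =>
    h (boundaryPos_injective h')
  have ip := h.invol p
  have iq := h.invol q
  have np := h.ne p
  have nq := h.ne q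
  have hn' : ∀ x z, z ≠ x → z ≠ σ x → (Btw x (σ x) z ↔ Btw x (σ x) (σ z)) := fun x z h1 h2 =>
    ⟨hn x z h1 h2, fun h' => by
      have i1 := h.invol x
      have i2 := h.invol z
      have := hn x (σ z) (by grind) (by grind) h'
      rwa [i2] at this⟩
  have hB' : ∀ z, z ≠ p → z ≠ q → z ≠ σ p → z ≠ σ q → (Btw p q z ↔ Btw p q (σ z)) :=
    fun z h1 h2 h3 h4 => ⟨hB z h1 h2 h3 h4, fun h' => by
      have i2 := h.invol z
      have := hB (σ z) (by grind) (by grind) (by grind) (by grind) h'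
      rwa [i2] at this⟩
  have hside : ∀ u, u ≠ p → u ≠ q → u ≠ σ p → u ≠ σ q → (Btw u (σ u) p ↔ Btw u (σ u) q) := by
    intro u h1 h2 h3 h4
    have h5 := hB' u h1 h2 h3 h4
    have i2 := h.invol u
    have := inj u p h1
    have := inj u q h2
    have := inj (σ u) p (by grind)
    have := inj (σ u) q (by grind)
    unfold Btw at h5 ⊢
    omega
  have hpp : ∀ z, z ≠ p → z ≠ q → z ≠ σ p → z ≠ σ q →
      (Btw (σ p) (σ q) z ↔ Btw (σ p) (σ q) (σ z)) := by
    intro z h1 h2 h3 h4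
    have i2 := h.invol z
    have a1 := hn' p z h1 h3
    have a2 := hn' q z h2 h4
    have a3 := hB' z h1 h2 h3 h4
    have := inj z p h1
    have := inj z q h2
    have := inj z (σ p) h3
    have := inj z (σ q) h4
    have := inj (σ z) p (by grind)
    have := inj (σ z) q (by grind)
    have := inj (σ z) (σ p) (by grind)
    have := inj (σ z) (σ q) (by grind)
    have := inj p q hpq
    have := inj (σ p) (σ q) (by grind)
    have := inj (σ p) q hσ
    have := inj p (σ q) (by grind)
    unfold Btw at a1 a2 a3 ⊢
    omega
  have hs : ∀ x y z : DiagramVertex n, Btw x y z ↔ Btw y x z := fun x y z => or_comm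
  have hpp' : Btw (σ p) (σ q) p ↔ Btw (σ p) (σ q) q := by
    have a1 := hn' p q hpq.symm (Ne.symm hσ)
    have a2 := hn' q p hpq (by grind)
    have := inj (σ p) p np
    have := inj (σ q) q nq
    have := inj p q hpq
    have := inj (σ p) (σ q) (by grind)
    have := inj (σ p) q hσ
    have := inj p (σ q) (by grind)
    unfold Btw at a1 a2 hC ⊢
    omega
  have r1 : PartitionDiagram.reconnect p q σ p = q := by simp [PartitionDiagram.reconnect]
  have r2 : PartitionDiagram.reconnect p q σ q = p := by
    simp only [PartitionDiagram.reconnect]; grind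
  have r3 : PartitionDiagram.reconnect p q σ (σ p) = σ q := by
    simp only [PartitionDiagram.reconnect]; grind
  have r4 : PartitionDiagram.reconnect p q σ (σ q) = σ p := by
    simp only [PartitionDiagram.reconnect]; grind
  have r5 : ∀ x, x ≠ p → x ≠ q → x ≠ σ p → x ≠ σ q → PartitionDiagram.reconnect p q σ x = σ x := by
    intro x h1 h2 h3 h4
    simp [PartitionDiagram.reconnect, h1, h2, h3, h4]
  generalize PartitionDiagram.reconnect p q σ = R at *
  have main : ∀ x z, z ≠ x → z ≠ R x → (Btw x (R x) z ↔ Btw x (R x) (R z)) := by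
    intro x z hzx hzs
    by_cases x1 : x = p
    · subst x1
      rw [r1] at hzs ⊢
      by_cases z3 : z = σ x
      · rw [z3, r3, hC]
      by_cases z4 : z = σ q
      · rw [z4, r4, hC]
      rw [r5 z hzx hzs z3 z4, hB' z hzx hzs z3 z4]
    by_cases x2 : x = q
    · subst x2
      rw [r2] at hzs ⊢
      rw [hs x p z, hs x p (R z)]
      by_cases z3 : z = σ x
      · rw [z3, r4, hC]
      by_cases z4 : z = σ p
      · rw [z4, r3, hC]
      rw [r5 z hzs hzx z4 z3, hB' z hzs hzx z4 z3]
    by_cases x3 : x = σ p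
    · subst x3
      rw [r3] at hzs ⊢
      by_cases z3 : z = p
      · rw [z3, r1, hpp']
      by_cases z4 : z = q
      · rw [z4, r2, hpp']
      rw [r5 z z3 z4 hzx hzs, hpp z z3 z4 hzx hzs]
    by_cases x4 : x = σ q
    · subst x4
      rw [r4] at hzs ⊢
      rw [hs _ _ z, hs _ _ (R z)]
      by_cases z3 : z = p
      · rw [z3, r1, hpp']
      by_cases z4 : z = q
      · rw [z4, r2, hpp']
      rw [r5 z z3 z4 hzs hzx, hpp z z3 z4 hzs hzx]
    have ix := h.invol x
    have e1 := hside x x1 x2 x3 x4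
    have e2 := hn' x p (by grind) (by grind)
    have e3 := hn' x q (by grind) (by grind)
    rw [r5 x x1 x2 x3 x4] at hzs ⊢
    by_cases z1 : z = p
    · rw [z1, r1, e1]
    by_cases z2 : z = q
    · rw [z2, r2, e1]
    by_cases z3 : z = σ p
    · rw [z3, r3, ← e2, ← e3, e1]
    by_cases z4 : z = σ q
    · rw [z4, r4, ← e2, ← e3, e1]
    rw [r5 z z1 z2 z3 z4]
    exact hn' x z hzx hzs
  exact fun x z h1 h2 => (main x z h1 h2).1

theorem Noncrossing.reconnect_adjacent {σ : DiagramVertex n → DiagramVertex n}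
    (hn : Noncrossing σ) (h : IsMatching σ) {a b : Fin n} (hab : b.val = a.val + 1) :
    Noncrossing (PartitionDiagram.reconnect (.inl a) (.inl b) σ) := by
  have hz : ∀ z, ¬ Btw (.inl a) (.inl b) z := fun z hz => by
    simp only [Btw, boundaryPos] at hz
    omega
  exact hn.reconnect h (by simp [Fin.ext_iff]; omega) (iff_of_false (hz _) (hz _))
    fun z _ _ _ _ h => (hz z h).elim

theorem tau_mul_mem_jones {α : PartitionDiagram n} (h : α ∈ jones n) {i : ℕ} (hi : i + 1 < n) :
    tau n i * α ∈ jones n := by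
  obtain ⟨σ, hσ, hn⟩ := mem_jones_iff.1 h
  have hab : (⟨i + 1, hi⟩ : Fin n).val = (⟨i, by omega⟩ : Fin n).val + 1 := rfl
  exact mem_jones_iff.2 ⟨_, hσ.tau_mul hab, hn.reconnect_adjacent hσ.toIsMatching hab⟩

theorem one_mem_jones : (1 : PartitionDiagram n) ∈ jones n := by
  refine mem_jones_iff.2 ⟨_, represents_one, ?_⟩
  rintro (x | x) (z | z) h1 h2 h3 <;> simp only [Btw, boundaryPos, Sum.swap_inl, Sum.swap_inr] at h3 ⊢ <;> omega

/-! ### The `τᵢ` generate the singular part of the Jones monoid. -/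

theorem IsMatching.exists_represents {σ : DiagramVertex n → DiagramVertex n} (h : IsMatching σ) :
    ∃ α, Represents σ α := by
  refine ⟨⟨⟨fun x y => y = x ∨ y = σ x, fun x => .inl rfl, ?_, ?_⟩⟩, h, fun x y => Iff.rfl⟩
  · rintro x y (rfl | rfl)
    · exact .inl rfl
    · exact .inr (h.invol x).symm
  · rintro x y z (rfl | rfl) (rfl | rfl)
    · exact .inl rfl
    · exact .inr rfl
    · exact .inr rfl
    · exact .inl (h.invol x)

theorem exists_upper_hook {σ : DiagramVertex n → DiagramVertex n} {α : PartitionDiagram n}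
    (h : Represents σ α) (hn : Noncrossing σ) (hα : α ≠ 1) :
    ∃ a b : Fin n, b.val = a.val + 1 ∧ σ (.inl a) = .inl b := by
  by_contra! hno
  -- An upper chord of span greater than one traps the right neighbour of its left end, which is
  -- thus an end of a shorter upper chord.
  have h1 : ∀ d : ℕ, ∀ a c : Fin n, a < c → c.val - a.val = d → σ (.inl a) ≠ .inl c := by
    intro d
    induction d using Nat.strong_induction_on with
    | _ d ih =>
      intro a c hac hd hσ
      have hc : c.val ≠ a.val + 1 := fun h' => hno a c h' hσ
      have hac' : a.val < c.val := hac
      obtain ⟨e, he⟩ : ∃ e : Fin n, e.val = a.val + 1 := ⟨⟨a.val + 1, by omega⟩, rfl⟩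
      have hb := hn (.inl a) (.inl e) (by simp [Fin.ext_iff]; omega)
        (by rw [hσ]; simp [Fin.ext_iff]; omega)
        (by rw [hσ]; simp only [Btw, boundaryPos]; omega)
      have hne := h.ne (.inl e)
      rw [hσ] at hb
      rcases hf : σ (.inl e) with f | f
      · rw [hf] at hb hne
        have : f ≠ e := by simpa using hne
        have := Fin.val_ne_of_ne this
        simp only [Btw, boundaryPos] at hb
        exact ih (f.val - e.val) (by omega) e f (Fin.lt_def.2 (by omega)) rfl hf
      · rw [hf] at hb
        simp only [Btw, boundaryPos] at hb
        omega
  have h2 : ∀ a : Fin n, ∃ b, σ (.inl a) = .inr b := by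
    intro a
    rcases hf : σ (.inl a) with c | c
    · rcases lt_trichotomy a c with hac | rfl | hac
      · exact (h1 _ a c hac rfl hf).elim
      · exact (h.ne _ hf).elim
      · exact (h1 _ c a hac rfl (by rw [← hf, h.invol])).elim
    · exact ⟨c, rfl⟩
  choose g hg using h2
  -- With no upper chords all strings are transversal, and noncrossing strings preserve order, so
  -- the diagram is `1`.
  have hmono : StrictMono g := by
    intro a a' haa
    have haa' : a.val < a'.val := haa
    have hb := hn (.inl a) (.inl a') (by simp [Fin.ext_iff]; omega) (by simp [hg])
      (by rw [hg]; simp only [Btw, boundaryPos]; omega)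
    rw [hg, hg] at hb
    simp only [Btw, boundaryPos] at hb
    exact Fin.lt_def.2 (by omega)
  have hid : g = id := hmono.eq_id
  have : σ = Sum.swap := by
    funext x
    rcases x with a | a
    · simp [hg, hid]
    · have := h.invol (.inl a)
      rw [hg, hid] at this
      simpa using this
  subst this
  exact hα (h.eq represents_one)

/-- The column of a vertex. -/
def column : DiagramVertex n → ℕ
  | .inl k => k
  | .inr k => k

/-- Twice the total horizontal extent of the chords. -/
def width (σ : DiagramVertex n → DiagramVertex n) : ℕ :=
  ∑ x, ((column x - column (σ x)) + (column (σ x) - column x))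

/-- `c` and `σ c` lie on opposite sides of the gap between columns `a` and `b`. Trading `{a, b}`,
`{c, σ c}` for `{a, c}`, `{b, σ c}` saves two crossings of that gap. -/
theorem width_reconnect_lt {σ : DiagramVertex n → DiagramVertex n} (h : IsMatching σ) {a b : Fin n}
    (hab : b.val = a.val + 1) (hσ : σ (.inl a) = .inl b) {c : DiagramVertex n} (hca : c ≠ .inl a)
    (hc : column c ≤ a) (hd : b ≤ column (σ c)) :
    width (reconnect (.inl a) c σ) < width σ := by
  have ic := h.invol c
  have ia := h.invol (.inl a)
  have ib : σ (.inl b) = .inl a := by rw [← hσ, ia]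
  have hcb : c ≠ .inl b := by
    rintro rfl
    simp only [column] at hc
    omega
  set T : Finset (DiagramVertex n) := {.inl a, .inl b, c, σ c} with hT
  have hab' : (.inl a : DiagramVertex n) ≠ .inl b := by simp [Fin.ext_iff]; omega
  have d1 : σ c ≠ .inl a := by grind
  have d2 : σ c ≠ .inl b := by grind
  have d3 : σ c ≠ c := h.ne c
  have hsum : ∀ f : DiagramVertex n → ℕ,
      ∑ x ∈ T, f x = f (.inl a) + (f (.inl b) + (f c + f (σ c))) := by
    intro f
    rw [hT, Finset.sum_insert (by simp; grind), Finset.sum_insert (by simp; grind),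
      Finset.sum_insert (by simp; grind), Finset.sum_singleton]
  unfold width
  rw [← Finset.sum_add_sum_compl T, ← Finset.sum_add_sum_compl T, hsum, hsum]
  have hcompl : ∑ x ∈ Tᶜ, ((column x - column (reconnect (.inl a) c σ x)) +
      (column (reconnect (.inl a) c σ x) - column x)) =
      ∑ x ∈ Tᶜ, ((column x - column (σ x)) + (column (σ x) - column x)) := by
    refine Finset.sum_congr rfl fun x hx => ?_
    have : reconnect (.inl a) c σ x = σ x := by
      simp only [hT, Finset.mem_compl, Finset.mem_insert, Finset.mem_singleton] at hx
      simp only [reconnect]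
      grind
    rw [this]
  have r1 : reconnect (.inl a) c σ (.inl a) = c := by simp [reconnect]
  have r2 : reconnect (.inl a) c σ (.inl b) = σ c := by simp only [reconnect]; grind
  have r3 : reconnect (.inl a) c σ c = .inl a := by simp only [reconnect]; grind
  have r4 : reconnect (.inl a) c σ (σ c) = .inl b := by simp only [reconnect]; grind
  rw [hcompl, r1, r2, r3, r4, hσ, ib, ic]
  have e1 : column (.inl a : DiagramVertex n) = a := rfl
  have e2 : column (.inl b : DiagramVertex n) = b := rfl
  omega

/-- A parity argument: an even number of vertices lie in columns from `b` on, and `b` itself is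
matched outside them, so another vertex is too. The minimal choice of `d` serves to keep the
quotient diagram noncrossing. -/
theorem exists_crossing_chord {σ : DiagramVertex n → DiagramVertex n} (h : IsMatching σ)
    {a b : Fin n} (hab : b.val = a.val + 1) (hσ : σ (.inl a) = .inl b) :
    ∃ d, d ≠ .inl b ∧ column (σ d) ≤ a ∧ b ≤ column d ∧
      ∀ z, z ≠ .inl b → column (σ z) ≤ a → b ≤ column z → boundaryPos d ≤ boundaryPos z := by
  have hex : ∃ d, d ≠ .inl b ∧ column (σ d) ≤ a ∧ b ≤ column d := by
    by_contra! hno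
    have hσb : σ (.inl b) = .inl a := by rw [← hσ, h.invol]
    let S : Finset (DiagramVertex n) := (Finset.Ici b).disjSum (Finset.Ici b)
    have hS : ∀ z, z ∈ S ↔ b ≤ column z := by
      rintro (z | z) <;> simp [S, column]
    have hbS : .inl b ∈ S := (hS _).2 le_rfl
    have hsum : ∑ z ∈ S.erase (.inl b), (1 : ZMod 2) = 0 := by
      refine Finset.sum_involution (fun z _ => σ z) (fun _ _ => by decide)
        (fun z _ _ => h.ne z) (fun z hz => ?_) (fun z _ => h.invol z)
      obtain ⟨hzb, hz⟩ := Finset.mem_erase.1 hz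
      rw [hS] at hz
      have := hno z hzb
      refine Finset.mem_erase.2 ⟨fun h' => ?_, (hS _).2 (by omega)⟩
      have h1 : z = .inl a := by rw [← h.invol z, h', hσb]
      rw [h1] at hz
      simp only [column] at hz
      omega
    have hcard : S.card = 2 * (n - b) := by simp [S]; omega
    have hpos : 0 < S.card := Finset.card_pos.2 ⟨_, hbS⟩
    rw [Finset.sum_const, nsmul_one, Finset.card_erase_of_mem hbS,
      (ZMod.natCast_eq_zero_iff_even)] at hsum
    obtain ⟨k, hk⟩ := hsum
    omega
  obtain ⟨d, hd, hmin⟩ := Finset.exists_min_image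
    {d | d ≠ .inl b ∧ column (σ d) ≤ a ∧ b ≤ column d} boundaryPos
    (hex.imp fun d hd => Finset.mem_filter.2 ⟨Finset.mem_univ _, hd⟩)
  obtain ⟨-, h1, h2, h3⟩ := Finset.mem_filter.1 hd
  exact ⟨d, h1, h2, h3, fun z z1 z2 z3 =>
    hmin z (Finset.mem_filter.2 ⟨Finset.mem_univ _, z1, z2, z3⟩)⟩

/-- Every element other than `1` of the Jones monoid is divisible on the left by some `τᵢ`,
with a quotient of smaller width. -/
theorem exists_eq_tau_mul {σ : DiagramVertex n → DiagramVertex n} {α : PartitionDiagram n}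
    (h : Represents σ α) (hn : Noncrossing σ) (hα : α ≠ 1) :
    ∃ i, i + 1 < n ∧ ∃ σ' β, Represents σ' β ∧ Noncrossing σ' ∧ α = tau n i * β ∧
      width σ' < width σ := by
  obtain ⟨a, b, hab, hσ⟩ := exists_upper_hook h hn hα
  obtain ⟨d, hdb, hc, hd, hmin⟩ := exists_crossing_chord h.toIsMatching hab hσ
  have hσb : σ (.inl b) = .inl a := by rw [← hσ, h.invol]
  obtain ⟨c, hcd⟩ : ∃ c, σ d = c := ⟨_, rfl⟩
  have hdc : σ c = d := by rw [← hcd, h.invol]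
  rw [hcd] at hc
  have hca : c ≠ .inl a := by grind
  have hm := h.toIsMatching.reconnect hca.symm
  have inj : ∀ x y : DiagramVertex n, x ≠ y → boundaryPos x ≠ boundaryPos y := fun x y h h' =>
    h (boundaryPos_injective h')
  have hcol : ∀ z : DiagramVertex n, b ≤ column z ↔ boundaryPos (.inl a) < boundaryPos z ∧
      boundaryPos z + a + 1 < 2 * n := by
    rintro (z | z) <;> simp only [column, boundaryPos] <;> omega
  have hcol' : ∀ z : DiagramVertex n, column z ≤ a ↔ ¬ b ≤ column z := fun z => by omega
  have eab : boundaryPos (.inl b) = boundaryPos (.inl a) + 1 := hab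
  have ea : boundaryPos (.inl a) = a.val := rfl
  have hlt : ∀ z : DiagramVertex n, boundaryPos z < 2 * n := by
    rintro (z | z) <;> simp only [boundaryPos] <;> omega
  have c1 := inj c _ hca
  have d1 := inj d _ hdb
  rw [hcol', hcol] at hc
  have hd' := (hcol d).1 hd
  have hlc := hlt c
  -- A chord crossing `{a, c}` but not `{c, d}` would straddle the gap with an end past `b` that
  -- precedes `d` along the boundary, against the minimality of `d`.
  have hnc : Noncrossing (reconnect (.inl a) c σ) := by
    refine hn.reconnect h.toIsMatching hca.symm ?_ fun z z1 z2 z3 z4 => ?_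
    · rw [hσ, hdc]
      unfold Btw
      omega
    · rw [hσ] at z3
      rw [hdc] at z4
      have iz := h.invol z
      have b1 := hn c z z2 (by rwa [hdc])
      have b2 := hmin z z3
      have b3 := hmin (σ z) (by grind)
      rw [iz] at b3
      rw [hcol', hcol, hcol] at b2 b3
      rw [hdc] at b1
      have p1 := inj z _ z1
      have p2 := inj z _ z2
      have p3 := inj z _ z3
      have p4 := inj z _ z4
      have q1 := inj (σ z) (.inl a) (by grind)
      have q2 := inj (σ z) c (by grind)
      have q3 := inj (σ z) (.inl b) (by grind)
      have q4 := inj (σ z) d (by grind)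
      unfold Btw at b1 ⊢
      omega
  obtain ⟨β, hβ⟩ := hm.exists_represents
  refine ⟨a, by omega, _, β, hβ, hnc, h.eq ?_, ?_⟩
  · have := hβ.tau_mul hab
    rwa [reconnect_reconnect h.toIsMatching hσ (by grind)] at this
  · exact width_reconnect_lt h.toIsMatching hab hσ hca (by rw [hcol', hcol]; exact hc)
      (by rw [hdc]; exact hd)

/-- Strong induction on `width`. The case of quotient `1` is a separate base because the semigroup
has no empty product. -/
theorem jones_induction {P : PartitionDiagram n → Prop} (h₁ : ∀ i, i + 1 < n → P (tau n i))
    (h₂ : ∀ i α, i + 1 < n → α ∈ jones n → α ≠ 1 → P α → P (tau n i * α))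
    {α : PartitionDiagram n} (hα : α ∈ jones n) (hne : α ≠ 1) : P α := by
  obtain ⟨σ, hσ, hn⟩ := mem_jones_iff.1 hα
  clear hα
  induction hw : width σ using Nat.strong_induction_on generalizing σ α with
  | _ w ih =>
    obtain ⟨i, hi, σ', β, hβ, hn', rfl, hlt⟩ := exists_eq_tau_mul hσ hn hne
    by_cases hb : β = 1
    · have := tau_mul_one (n := n) (a := ⟨i, by omega⟩) (b := ⟨i + 1, hi⟩) rfl
      simp only at this
      rw [hb, this]
      exact h₁ i hi
    · exact h₂ i β hi (mem_jones_iff.2 ⟨_, hβ, hn'⟩) hb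
        (ih _ (hw ▸ hlt) hb _ hβ hn' rfl)

/-! ### Rank and upper hooks. -/

theorem Represents.rank_eq {σ : DiagramVertex n → DiagramVertex n} {α : PartitionDiagram n}
    (h : Represents σ α) :
    α.rank = (Finset.univ.filter fun k : Fin n => (σ (.inl k)).isRight).card := by
  have himage : {B ∈ α.rel.classes | (∃ i, Sum.inl i ∈ B) ∧ ∃ j, Sum.inr j ∈ B} =
      (fun k : Fin n => {z | α.rel z (.inl k)}) ''
        (Finset.univ.filter fun k : Fin n => (σ (.inl k)).isRight) := by
    ext B
    constructor
    · rintro ⟨⟨y, rfl⟩, ⟨i, hi⟩, j, hj⟩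
      have hij : α.rel (.inl i) (.inr j) := α.rel.trans' hi (α.rel.symm' hj)
      refine ⟨i, ?_, ?_⟩
      · rw [Finset.coe_filter]
        refine ⟨Finset.mem_univ _, ?_⟩
        rw [h.apply_eq hij (by simp)]
        rfl
      · ext z
        exact ⟨fun hz => α.rel.trans' hz hi, fun hz => α.rel.trans' hz (α.rel.symm' hi)⟩
    · rintro ⟨k, hk, rfl⟩
      rw [Finset.coe_filter] at hk
      obtain ⟨j, hj⟩ := Sum.isRight_iff.1 hk.2
      refine ⟨⟨_, rfl⟩, ⟨k, α.rel.refl' _⟩, j, α.rel.symm' ?_⟩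
      rw [← hj]
      exact h.rel_apply _
  unfold rank
  rw [himage, Set.InjOn.ncard_image, Set.ncard_coe_finset]
  intro k hk k' _ hkk
  rw [Finset.coe_filter] at hk
  have hmem : (.inl k : DiagramVertex n) ∈ {z | α.rel z (.inl k)} := α.rel.refl' _
  simp only at hkk
  rw [hkk] at hmem
  by_contra hne
  have := h.apply_eq hmem (by simpa using Ne.symm hne)
  have hk2 := hk.2
  rw [this] at hk2
  simp at hk2

theorem Represents.rank_add_card {σ : DiagramVertex n → DiagramVertex n} {α : PartitionDiagram n}
    (h : Represents σ α) :
    α.rank + (Finset.univ.filter fun k : Fin n => ¬ (σ (.inl k)).isRight).card = n := by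
  rw [h.rank_eq, Finset.card_filter_add_card_filter_not, Finset.card_univ, Fintype.card_fin]

/-- `{i, i + 1}` is contained in a block of `α`. -/
def UpperHook (α : PartitionDiagram n) (i : ℕ) : Prop :=
  ∃ h : i + 1 < n, α.rel (.inl ⟨i, by omega⟩) (.inl ⟨i + 1, h⟩)

theorem UpperHook.mul {α : PartitionDiagram n} {i : ℕ} (h : α.UpperHook i)
    (β : PartitionDiagram n) : (α * β).UpperHook i :=
  ⟨h.1, mul_rel_inl β h.2⟩

theorem UpperHook.ne_one {α : PartitionDiagram n} {i : ℕ} (h : α.UpperHook i) : α ≠ 1 := by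
  rintro rfl
  obtain ⟨hi, h⟩ := h
  have := represents_one.apply_eq h (by simp)
  simp at this

theorem UpperHook.apply_eq {σ : DiagramVertex n → DiagramVertex n} {α : PartitionDiagram n} {i : ℕ}
    (h : α.UpperHook i) (hσ : Represents σ α) (hi : i + 1 < n) :
    σ (.inl ⟨i, by omega⟩) = .inl ⟨i + 1, hi⟩ :=
  hσ.apply_eq h.2 (by simp)

theorem tau_mem_jones {i : ℕ} (hi : i + 1 < n) : tau n i ∈ jones n := by
  have h := tau_mul_one (n := n) (a := ⟨i, by omega⟩) (b := ⟨i + 1, hi⟩) rfl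
  rw [← h]
  exact tau_mul_mem_jones one_mem_jones hi

theorem upperHook_tau {i : ℕ} (hi : i + 1 < n) : (tau n i).UpperHook i := by
  have h := represents_tau (n := n) (a := ⟨i, by omega⟩) (b := ⟨i + 1, hi⟩) rfl
  refine ⟨hi, (h.rel_iff _ _).2 (.inr ?_)⟩
  simp [reconnect]

theorem rank_tau {i : ℕ} (hi : i + 1 < n) : (tau n i).rank + 2 = n := by
  have h := represents_tau (n := n) (a := ⟨i, by omega⟩) (b := ⟨i + 1, hi⟩) rfl
  have hc := h.rank_add_card
  have : (Finset.univ.filter fun k : Fin n => ¬ (reconnect (.inl ⟨i, by omega⟩)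
      (.inl ⟨i + 1, hi⟩) Sum.swap (.inl k)).isRight) = {⟨i, by omega⟩, ⟨i + 1, hi⟩} := by
    ext k
    by_cases h1 : k = ⟨i, by omega⟩ <;> by_cases h2 : k = ⟨i + 1, hi⟩ <;>
      simp [reconnect, h1, h2]
  rw [this, Finset.card_pair (by simp)] at hc
  exact hc

theorem rank_add_four_le {α : PartitionDiagram n} (hα : α ∈ jones n) {j k : ℕ}
    (hj : α.UpperHook j) (hk : α.UpperHook k) (hjk : j + 2 ≤ k) : α.rank + 4 ≤ n := by
  obtain ⟨σ, hσ, -⟩ := mem_jones_iff.1 hα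
  obtain ⟨hj', -⟩ := id hj
  obtain ⟨hk', -⟩ := id hk
  have e1 := hj.apply_eq hσ hj'
  have e2 := hk.apply_eq hσ hk'
  have e3 := hσ.invol (.inl ⟨j, by omega⟩)
  have e4 := hσ.invol (.inl ⟨k, by omega⟩)
  rw [e1] at e3
  rw [e2] at e4
  have hc := hσ.rank_add_card
  have hsub : ({⟨j, by omega⟩, ⟨j + 1, hj'⟩, ⟨k, by omega⟩, ⟨k + 1, hk'⟩} : Finset (Fin n)) ⊆
      Finset.univ.filter fun k : Fin n => ¬ (σ (.inl k)).isRight := by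
    intro x hx
    simp only [Finset.mem_insert, Finset.mem_singleton] at hx
    rw [Finset.mem_filter]
    rcases hx with rfl | rfl | rfl | rfl <;> simp [e1, e2, e3, e4]
  have hcard := Finset.card_le_card hsub
  rw [Finset.card_insert_of_notMem, Finset.card_insert_of_notMem, Finset.card_pair] at hcard
  · omega
  all_goals simp
  all_goals omega

theorem tau_mul_eq_self {α : PartitionDiagram n} (hα : α ∈ jones n) {i : ℕ} (h : α.UpperHook i) :
    tau n i * α = α := by
  obtain ⟨σ, hσ, -⟩ := mem_jones_iff.1 hα
  obtain ⟨hi, -⟩ := id h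
  have := hσ.tau_mul (a := ⟨i, by omega⟩) (b := ⟨i + 1, hi⟩) rfl
  rw [reconnect_eq_self hσ.toIsMatching (h.apply_eq hσ hi)] at this
  exact this.eq hσ

/-- The Jones relation `τᵢτⱼτᵢ = τᵢ` for adjacent indices, acting on elements already fixed by `τᵢ`:
the second reconnection undoes the first. -/
theorem tau_mul_tau_mul {α : PartitionDiagram n} (hα : α ∈ jones n) {i j : ℕ} (h : α.UpperHook i)
    (hj : j + 1 < n) (hij : j = i + 1 ∨ i = j + 1) : tau n i * (tau n j * α) = α := by
  obtain ⟨σ, hσ, -⟩ := mem_jones_iff.1 hα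
  obtain ⟨hi, -⟩ := id h
  have h1 := (hσ.tau_mul (a := ⟨j, by omega⟩) (b := ⟨j + 1, hj⟩) rfl).tau_mul
    (a := ⟨i, by omega⟩) (b := ⟨i + 1, hi⟩) rfl
  refine h1.eq ?_
  have e := h.apply_eq hσ hi
  have e' : σ (.inl ⟨i + 1, hi⟩) = .inl ⟨i, by omega⟩ := by rw [← e, hσ.invol]
  rcases hij with rfl | rfl
  · have hm := hσ.toIsMatching.reconnect
      (p := .inl ⟨i + 1, hi⟩) (q := .inl ⟨i + 1 + 1, hj⟩) (by simp)
    rw [reconnect_comm hm, reconnect_reconnect hσ.toIsMatching e' (by simp; omega)]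
    exact hσ
  · rw [reconnect_comm hσ.toIsMatching, reconnect_reconnect hσ.toIsMatching e (by simp; omega)]
    exact hσ

theorem UpperHook.tau_mul {α : PartitionDiagram n} (hα : α ∈ jones n) {j k : ℕ}
    (h : α.UpperHook k) (hj : j + 1 < n) (hjk : j + 2 ≤ k ∨ k + 2 ≤ j) :
    (tau n j * α).UpperHook k := by
  obtain ⟨σ, hσ, -⟩ := mem_jones_iff.1 hα
  obtain ⟨hk, -⟩ := id h
  refine ⟨hk, ((hσ.tau_mul (a := ⟨j, by omega⟩) (b := ⟨j + 1, hj⟩) rfl).rel_iff _ _).2 (.inr ?_)⟩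
  have e := h.apply_eq hσ hk
  have e1 := hσ.invol (.inl ⟨k, by omega⟩)
  have e2 := hσ.invol (.inl ⟨j, by omega⟩)
  have e3 := hσ.invol (.inl ⟨j + 1, hj⟩)
  have n1 : (⟨k, by omega⟩ : Fin n) ≠ ⟨j, by omega⟩ := by simp; omega
  have n2 : (⟨k, by omega⟩ : Fin n) ≠ ⟨j + 1, by omega⟩ := by simp; omega
  have n3 : (⟨k + 1, by omega⟩ : Fin n) ≠ ⟨j, by omega⟩ := by simp; omega
  have n4 : (⟨k + 1, by omega⟩ : Fin n) ≠ ⟨j + 1, by omega⟩ := by simp; omega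
  simp only [reconnect]
  grind

theorem upperHook_tau_mul {i : ℕ} (hi : i + 1 < n) (α : PartitionDiagram n) :
    (tau n i * α).UpperHook i := (upperHook_tau hi).mul α

/-- Two hooks at distance at least two cost four upper vertices, and two adjacent hooks would give
one vertex two partners. -/
theorem UpperHook.eq_of_rank {α : PartitionDiagram n} (hα : α ∈ jones n) (hr : α.rank + 2 = n)
    {j k : ℕ} (hj : α.UpperHook j) (hk : α.UpperHook k) : j = k := by
  obtain ⟨σ, hσ, -⟩ := mem_jones_iff.1 hα
  have key : ∀ i, α.UpperHook i → ¬ α.UpperHook (i + 1) := by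
    intro i h h'
    have e := hσ.invol (.inl ⟨i, by have := h.1; omega⟩)
    rw [h.apply_eq hσ h.1, h'.apply_eq hσ h'.1] at e
    simp at e
    omega
  by_contra hne
  have h1 := rank_add_four_le hα hj hk
  have h2 := rank_add_four_le hα hk hj
  rcases Nat.lt_or_gt_of_ne hne with h | h
  · obtain rfl : k = j + 1 := by omega
    exact key _ hj hk
  · obtain rfl : j = k + 1 := by omega
    exact key _ hk hj

theorem Represents.star {σ : DiagramVertex n → DiagramVertex n} {α : PartitionDiagram n}
    (h : Represents σ α) : Represents (fun x => (σ x.swap).swap) (star α) := by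
  refine ⟨⟨fun x hx => h.ne x.swap ?_, fun x => ?_⟩, fun x y => ?_⟩
  · rw [← Sum.swap_swap (σ x.swap), hx]
  · simp [h.invol]
  · rw [star_rel, h.rel_iff]
    refine or_congr Sum.swap_leftInverse.injective.eq_iff ⟨fun h' => ?_, fun h' => ?_⟩
    · rw [← h', Sum.swap_swap]
    · rw [h', Sum.swap_swap]

theorem star_tau {i : ℕ} (hi : i + 1 < n) : star (tau n i) = tau n i := by
  have h := represents_tau (n := n) (a := ⟨i, by omega⟩) (b := ⟨i + 1, hi⟩) rfl
  refine h.star.eq ?_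
  convert h using 1
  funext x
  rcases x with x | x <;> simp only [reconnect] <;> grind [Sum.swap]

theorem tau_mul_tau_succ {i : ℕ} (hi : i + 2 < n) : tau n i * tau n (i + 1) = lam n i := by
  obtain ⟨a, ha⟩ : ∃ a : Fin n, a.val = i := ⟨⟨i, by omega⟩, rfl⟩
  obtain ⟨b, hb⟩ : ∃ b : Fin n, b.val = i + 1 := ⟨⟨i + 1, by omega⟩, rfl⟩
  obtain ⟨c, hc⟩ : ∃ c : Fin n, c.val = i + 2 := ⟨⟨i + 2, by omega⟩, rfl⟩
  have h := represents_tau (a := b) (b := c) (by omega)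
  have h' := h.tau_mul (a := a) (b := b) (by omega)
  rw [ha, hb] at h'
  refine h'.eq (represents_ofGraph h'.toIsMatching ?_ ?_)
  · rintro (x | x) (y | y) h <;> simp only [lamEdge, reconnect] at h ⊢ <;> grind [Sum.swap]
  · rintro (x | x) <;> simp only [reconnect] <;> grind [Sum.swap, lamEdge]

theorem tau_succ_mul_tau {i : ℕ} (hi : i + 2 < n) : tau n (i + 1) * tau n i = rho n i := by
  obtain ⟨a, ha⟩ : ∃ a : Fin n, a.val = i := ⟨⟨i, by omega⟩, rfl⟩
  obtain ⟨b, hb⟩ : ∃ b : Fin n, b.val = i + 1 := ⟨⟨i + 1, by omega⟩, rfl⟩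
  obtain ⟨c, hc⟩ : ∃ c : Fin n, c.val = i + 2 := ⟨⟨i + 2, by omega⟩, rfl⟩
  have h := represents_tau (a := a) (b := b) (by omega)
  have h' := h.tau_mul (a := b) (b := c) (by omega)
  rw [ha, hb] at h'
  refine h'.eq (represents_ofGraph h'.toIsMatching ?_ ?_)
  · rintro (x | x) (y | y) h <;> simp only [rhoEdge, reconnect] at h ⊢ <;> grind [Sum.swap]
  · rintro (x | x) <;> simp only [reconnect] <;> grind [Sum.swap, rhoEdge]

/-! ### Multiplication of the elements of rank `n - 2`. -/

/-- The product `τₖ ⋯ τₗ`, in which consecutive indices differ by one.  It is the element of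
rank `n - 2` with upper hook `k` and lower hook `l`. -/
def hookProd (n k l : ℕ) : PartitionDiagram n :=
  if k = l then tau n l
  else if k < l then tau n k * hookProd n (k + 1) l
  else tau n k * hookProd n (k - 1) l
termination_by (k - l) + (l - k)

theorem hookProd_self (n l : ℕ) : hookProd n l l = tau n l := by
  rw [hookProd, if_pos rfl]

theorem hookProd_of_lt {k l : ℕ} (h : k < l) :
    hookProd n k l = tau n k * hookProd n (k + 1) l := by
  rw [hookProd, if_neg h.ne, if_pos h]

theorem hookProd_succ {k l : ℕ} (h : l ≤ k) :
    hookProd n (k + 1) l = tau n (k + 1) * hookProd n k l := by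
  rw [hookProd, if_neg (by omega), if_neg (by omega), Nat.add_sub_cancel]

theorem hookProd_mem_jones_and_upperHook {k l : ℕ} (hk : k + 1 < n) (hl : l + 1 < n) :
    hookProd n k l ∈ jones n ∧ (hookProd n k l).UpperHook k := by
  rcases Nat.lt_or_ge k l with h | h
  · refine Nat.decreasingInduction' (P := fun k => hookProd n k l ∈ jones n ∧
      (hookProd n k l).UpperHook k) (fun k hk _ ih => ?_) h.le ?_
    · rw [hookProd_of_lt hk]
      exact ⟨tau_mul_mem_jones ih.1 (by omega), upperHook_tau_mul (by omega) _⟩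
    · rw [hookProd_self]
      exact ⟨tau_mem_jones hl, upperHook_tau hl⟩
  · induction k, h using Nat.le_induction with
    | base =>
      rw [hookProd_self]
      exact ⟨tau_mem_jones hl, upperHook_tau hl⟩
    | succ k h ih =>
      rw [hookProd_succ h]
      exact ⟨tau_mul_mem_jones (ih (by omega)).1 hk, upperHook_tau_mul hk _⟩

theorem hookProd_mem_jones {k l : ℕ} (hk : k + 1 < n) (hl : l + 1 < n) :
    hookProd n k l ∈ jones n := (hookProd_mem_jones_and_upperHook hk hl).1

theorem upperHook_hookProd {k l : ℕ} (hk : k + 1 < n) (hl : l + 1 < n) :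
    (hookProd n k l).UpperHook k := (hookProd_mem_jones_and_upperHook hk hl).2

/-- The indices `i` and `j` differ by at most one. -/
def Near (i j : ℕ) : Prop := i ≤ j + 1 ∧ j ≤ i + 1

theorem tau_mul_hookProd {j k l : ℕ} (hj : j + 1 < n) (hk : k + 1 < n) (hl : l + 1 < n)
    (hjk : Near j k) : tau n j * hookProd n k l = hookProd n j l := by
  have hjk1 := hjk.1
  have hjk2 := hjk.2
  obtain rfl | rfl | rfl : j = k ∨ j = k + 1 ∨ k = j + 1 := by omega
  · exact tau_mul_eq_self (hookProd_mem_jones hk hl) (upperHook_hookProd hk hl)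
  · rcases Nat.lt_or_ge k l with h | h
    · rw [hookProd_of_lt h]
      exact tau_mul_tau_mul (hookProd_mem_jones hj hl) (upperHook_hookProd hj hl) hk (.inr rfl)
    · rw [hookProd_succ h]
  · rcases Nat.lt_or_ge j l with h | h
    · rw [hookProd_of_lt h]
    · rw [hookProd_succ h]
      exact tau_mul_tau_mul (hookProd_mem_jones hj hl) (upperHook_hookProd hj hl) hk (.inl rfl)

/-- Walks from `l` to `k` in unit steps; combined with `tau_mul_hookProd` it moves the upper hook
while the lower one stays fixed. -/
theorem hookProd_induction {P : ℕ → Prop} {l : ℕ} (hl : l + 1 < n) (h₁ : P l)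
    (h₂ : ∀ j k, j + 1 < n → k + 1 < n → Near j k → P k → P j) {k : ℕ} (hk : k + 1 < n) : P k := by
  rcases Nat.le_total k l with h | h
  · exact Nat.decreasingInduction' (fun k hkl _ ih =>
      h₂ k (k + 1) (by omega) (by omega) ⟨by omega, by omega⟩ ih) h h₁
  · induction k, h using Nat.le_induction with
    | base => exact h₁
    | succ k h ih => exact h₂ (k + 1) k hk (by omega) ⟨by omega, by omega⟩ (ih (by omega))

theorem hookProd_mul_hookProd {i j k l : ℕ} (hi : i + 1 < n) (hj : j + 1 < n) (hk : k + 1 < n)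
    (hl : l + 1 < n) (hjk : Near j k) : hookProd n i j * hookProd n k l = hookProd n i l := by
  refine hookProd_induction (P := fun i => hookProd n i j * hookProd n k l = hookProd n i l) hj
    ?_ ?_ hi
  · rw [hookProd_self, tau_mul_hookProd hj hk hl hjk]
  · intro i i' hi hi' hn ih
    rw [← tau_mul_hookProd hi hi' hj hn, mul_assoc', ih, tau_mul_hookProd hi hi' hl hn]

theorem rank_hookProd_mul_le {k l : ℕ} (hk : k + 1 < n) (hl : l + 1 < n) (α : PartitionDiagram n) :
    (hookProd n k l * α).rank ≤ (tau n l * α).rank := by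
  refine hookProd_induction (P := fun k => (hookProd n k l * α).rank ≤ (tau n l * α).rank) hl
    ?_ ?_ hk
  · rw [hookProd_self]
  · intro i i' hi hi' hn ih
    rw [← tau_mul_hookProd hi hi' hl hn, mul_assoc']
    exact (rank_mul_le _ _).trans ih

/-- Elements with adjacent upper hooks are left multiples of each other, so their ranks agree. -/
theorem rank_hookProd {k l : ℕ} (hk : k + 1 < n) (hl : l + 1 < n) :
    (hookProd n k l).rank + 2 = n := by
  refine hookProd_induction (P := fun k => (hookProd n k l).rank + 2 = n) hl
    (by rw [hookProd_self, rank_tau hl]) ?_ hk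
  intro i i' hi hi' hn ih
  have h1 := rank_mul_le (tau n i) (hookProd n i' l)
  have h2 := rank_mul_le (tau n i') (hookProd n i l)
  rw [tau_mul_hookProd hi hi' hl hn] at h1
  rw [tau_mul_hookProd hi' hi hl ⟨hn.2, hn.1⟩] at h2
  omega

theorem star_hookProd {k l : ℕ} (hk : k + 1 < n) (hl : l + 1 < n) :
    star (hookProd n k l) = hookProd n l k := by
  refine hookProd_induction (P := fun k => star (hookProd n k l) = hookProd n l k) hl
    (by rw [hookProd_self, star_tau hl]) ?_ hk
  intro i i' hi hi' hn ih
  rw [← tau_mul_hookProd hi hi' hl hn, star_mul', ih, star_tau hi, ← hookProd_self,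
    hookProd_mul_hookProd hl hi' hi hi ⟨hn.2, hn.1⟩]

theorem rank_tau_mul_hookProd_lt {j k l : ℕ} (hj : j + 1 < n) (hk : k + 1 < n) (hl : l + 1 < n)
    (hjk : ¬ Near j k) : (tau n j * hookProd n k l).rank + 2 < n := by
  have hJ := hookProd_mem_jones hk hl
  have hfar : j + 2 ≤ k ∨ k + 2 ≤ j := by unfold Near at hjk; omega
  have h1 := (upperHook_hookProd hk hl).tau_mul hJ hj hfar
  have h2 := upperHook_tau_mul hj (hookProd n k l)
  have h3 := rank_add_four_le (tau_mul_mem_jones hJ hj) h1 h2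
  have h4 := rank_add_four_le (tau_mul_mem_jones hJ hj) h2 h1
  omega

theorem hookProd_inj {i j k l : ℕ} (hi : i + 1 < n) (hj : j + 1 < n) (hk : k + 1 < n)
    (hl : l + 1 < n) (h : hookProd n i j = hookProd n k l) : i = k ∧ j = l := by
  refine ⟨?_, ?_⟩
  · refine UpperHook.eq_of_rank (hookProd_mem_jones hi hj) (rank_hookProd hi hj)
      (upperHook_hookProd hi hj) ?_
    rw [h]
    exact upperHook_hookProd hk hl
  · have h' := congrArg star h
    rw [star_hookProd hi hj, star_hookProd hk hl] at h'
    refine UpperHook.eq_of_rank (hookProd_mem_jones hj hi) (rank_hookProd hj hi)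
      (upperHook_hookProd hj hi) ?_
    rw [h']
    exact upperHook_hookProd hl hk

theorem rank_lt_or_eq_hookProd {α : PartitionDiagram n} (hα : α ∈ jones n) (hne : α ≠ 1) :
    α.rank + 2 < n ∨ ∃ k l, k + 1 < n ∧ l + 1 < n ∧ α = hookProd n k l := by
  refine jones_induction (P := fun α => α.rank + 2 < n ∨ ∃ k l, k + 1 < n ∧ l + 1 < n ∧
    α = hookProd n k l) (fun i hi => .inr ⟨i, i, hi, hi, (hookProd_self n i).symm⟩) ?_ hα hne
  rintro i β hi - - (h | ⟨k, l, hk, hl, rfl⟩)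
  · exact .inl (lt_of_le_of_lt (Nat.add_le_add_right (rank_mul_le _ _) 2) h)
  · by_cases hik : Near i k
    · exact .inr ⟨i, l, hi, hl, tau_mul_hookProd hi hk hl hik⟩
    · exact .inl (rank_tau_mul_hookProd_lt hi hk hl hik)

theorem hookProd_mem_subtopIdempotents {k l : ℕ} (hk : k + 1 < n) (hl : l + 1 < n)
    (hkl : Near k l) : hookProd n k l ∈ subtopIdempotents n :=
  ⟨hookProd_mem_jones hk hl, hookProd_mul_hookProd hk hl hk hl ⟨hkl.2, hkl.1⟩, rank_hookProd hk hl⟩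

theorem mem_subtopIdempotents_iff {α : PartitionDiagram n} :
    α ∈ subtopIdempotents n ↔
      ∃ k l, k + 1 < n ∧ l + 1 < n ∧ Near k l ∧ α = hookProd n k l := by
  refine ⟨fun ⟨hJ, hid, hr⟩ => ?_, ?_⟩
  · have hne : α ≠ 1 := by
      rintro rfl
      have h := represents_one (n := n).rank_eq
      simp at h
      omega
    rcases rank_lt_or_eq_hookProd hJ hne with h | ⟨k, l, hk, hl, rfl⟩
    · omega
    · refine ⟨k, l, hk, hl, ?_, rfl⟩
      by_contra hkl
      -- If `k` and `l` are not near, the square has rank below `n - 2`, so it cannot be the element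
      -- itself.
      have h1 := rank_hookProd_mul_le hk hl (hookProd n k l)
      have h2 := rank_tau_mul_hookProd_lt hl hk hl fun h => hkl ⟨h.2, h.1⟩
      rw [hid.eq] at h1
      omega
  · rintro ⟨k, l, hk, hl, hkl, rfl⟩
    exact hookProd_mem_subtopIdempotents hk hl hkl

theorem lam_eq_hookProd {i : ℕ} (hi : i + 2 < n) : lam n i = hookProd n i (i + 1) := by
  rw [← tau_mul_tau_succ hi, hookProd_of_lt (by omega), hookProd_self]

theorem rho_eq_hookProd {i : ℕ} (hi : i + 2 < n) : rho n i = hookProd n (i + 1) i := by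
  rw [← tau_succ_mul_tau hi, hookProd_succ le_rfl, hookProd_self]

theorem tau_injective {i j : ℕ} (hi : i + 1 < n) (hj : j + 1 < n) (h : tau n i = tau n j) :
    i = j := by
  rw [← hookProd_self, ← hookProd_self] at h
  exact (hookProd_inj hi hi hj hj h).1

/-! ### The digraph `Ξₙ(F)` in coordinates, and its circuits. -/

/-- The vertex `τᵢ` of `Ξₙ`. -/
def tauVertex (i : ℕ) (hi : i + 1 < n) : XiVertex n :=
  ⟨tau n i, hookProd_self n i ▸ hookProd_mem_subtopIdempotents hi hi ⟨by omega, by omega⟩,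
    star_tau hi⟩

theorem exists_eq_tauVertex (v : XiVertex n) : ∃ i, ∃ hi : i + 1 < n, v = tauVertex i hi := by
  obtain ⟨p, hp, hs⟩ := v
  obtain ⟨k, l, hk, hl, -, rfl⟩ := mem_subtopIdempotents_iff.1 hp
  rw [star_hookProd hk hl] at hs
  obtain ⟨rfl, -⟩ := hookProd_inj hl hk hk hl hs
  exact ⟨l, hk, Subtype.ext (hookProd_self n l)⟩

theorem near_iff {i j : ℕ} : Near i j ↔ i = j ∨ j = i + 1 ∨ i = j + 1 := by
  unfold Near
  omega

theorem xi_red_iff {F : Set (PartitionDiagram n)} {i j : ℕ} (hi : i + 1 < n) (hj : j + 1 < n) :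
    (Xi n F).red (tauVertex i hi) (tauVertex j hj) ↔ Near i j ∧ hookProd n i j ∈ F := by
  constructor
  · rintro (⟨k, hk, hF, h1, h2⟩ | ⟨k, hk, hF, h1, h2⟩ | ⟨k, hk, hF, h1, h2⟩)
    · obtain rfl := tau_injective hi hk h1
      obtain rfl := tau_injective hj hk h2
      exact ⟨near_iff.2 (.inl rfl), (hookProd_self n j).symm ▸ hF⟩
    · obtain rfl := tau_injective hi (by omega) h1
      obtain rfl := tau_injective hj (by omega) h2
      exact ⟨near_iff.2 (.inr (.inl rfl)), lam_eq_hookProd hk ▸ hF⟩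
    · obtain rfl := tau_injective hi (by omega) h1
      obtain rfl := tau_injective hj (by omega) h2
      exact ⟨near_iff.2 (.inr (.inr rfl)), rho_eq_hookProd hk ▸ hF⟩
  · rintro ⟨hn, hF⟩
    obtain rfl | rfl | rfl := near_iff.1 hn
    · exact .inl ⟨i, hi, hookProd_self n i ▸ hF, rfl, rfl⟩
    · exact .inr (.inl ⟨i, hj, (lam_eq_hookProd hj).symm ▸ hF, rfl, rfl⟩)
    · exact .inr (.inr ⟨j, hi, (rho_eq_hookProd hi).symm ▸ hF, rfl, rfl⟩)

theorem xi_blue_iff {F : Set (PartitionDiagram n)} {i j : ℕ} (hi : i + 1 < n) (hj : j + 1 < n) :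
    (Xi n F).blue (tauVertex i hi) (tauVertex j hj) ↔ Near i j := by
  change (tau n i * tau n j).rank + 2 = n ↔ _
  rw [← hookProd_self n j]
  constructor
  · intro h
    by_contra hn
    have := rank_tau_mul_hookProd_lt hi hj hj hn
    omega
  · intro h
    rw [tau_mul_hookProd hi hj hj h, rank_hookProd hi hj]

/-- Every vertex has a red loop, or a red arc to a neighbour together with the reverse arc. -/
def LocallyClosed (n : ℕ) (F : Set (PartitionDiagram n)) : Prop :=
  ∀ i, i + 1 < n → ∃ j, j + 1 < n ∧ Near i j ∧ hookProd n i j ∈ F ∧ hookProd n j i ∈ F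

theorem exists_red_of_rbrPath {V : Type*} {G : TwoColouredDigraph V} {u v : V}
    (h : G.RBRPath u v) : ∃ w, G.red w v := by
  induction h with
  | single h => exact ⟨_, h⟩
  | cons _ _ _ ih => exact ih

/-- `S` will be one strict side of `i` on the line. Red arcs from `i` or `S` land in `S`, and blue
arcs may fall back to `i` at worst, so a path, ending in a red arc, ends in `S`. -/
theorem rbrPath_invariant {F : Set (PartitionDiagram n)} {i : ℕ} {S : ℕ → Prop}
    (h₁ : ∀ a b, Near a b → hookProd n a b ∈ F → a = i ∨ S a → S b)
    (h₂ : ∀ a b, Near a b → S a → b = i ∨ S b) {u v : XiVertex n} (h : (Xi n F).RBRPath u v)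
    {a b : ℕ} {ha : a + 1 < n} {hb : b + 1 < n} (hu : u = tauVertex a ha) (hv : v = tauVertex b hb)
    (hSa : a = i ∨ S a) : S b := by
  induction h generalizing a with
  | single h =>
    subst hu hv
    obtain ⟨hn, hF⟩ := (xi_red_iff ha hb).1 h
    exact h₁ _ _ hn hF hSa
  | @cons u w x v h h' p ih =>
    obtain ⟨c, hc, rfl⟩ := exists_eq_tauVertex w
    obtain ⟨d, hd, rfl⟩ := exists_eq_tauVertex x
    subst hu
    obtain ⟨hn, hF⟩ := (xi_red_iff ha hc).1 h
    exact ih rfl hv (h₂ c d ((xi_blue_iff hc hd).1 h') (h₁ _ _ hn hF hSa))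

theorem exists_red_to_of_rbrPath {V : Type*} {G : TwoColouredDigraph V} {u v : V}
    (h : G.RBRPath u v) : ∃ w, G.red u w := by
  cases h with
  | single h => exact ⟨_, h⟩
  | cons h _ _ => exact ⟨_, h⟩

theorem locallyClosed_of_isRBRBase {F : Set (PartitionDiagram n)}
    (h : ∀ v, (Xi n F).IsRBRBase v) : LocallyClosed n F := by
  intro i hi
  by_contra! hno
  have hp : (Xi n F).RBRPath (tauVertex i hi) (tauVertex i hi) := h _
  obtain ⟨w, hw⟩ := exists_red_of_rbrPath hp
  obtain ⟨x, hx, rfl⟩ := exists_eq_tauVertex w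
  obtain ⟨hxi, hxF⟩ := (xi_red_iff hx hi).1 hw
  obtain ⟨w', hw'⟩ := exists_red_to_of_rbrPath hp
  obtain ⟨j, hj, rfl⟩ := exists_eq_tauVertex w'
  obtain ⟨hij, hjF⟩ := (xi_red_iff hi hj).1 hw'
  have h0 : hookProd n i i ∉ F := fun h' => hno i hi (near_iff.2 (.inl rfl)) h' h'
  have hix : hookProd n i x ∉ F := fun h' => hno x hx ⟨hxi.2, hxi.1⟩ h' hxF
  have hji : hookProd n j i ∉ F := hno j hj hij hjF
  have hcase : ∀ a b, hookProd n a b ∈ F → ¬ (a = i ∧ b = i) ∧ ¬ (a = i ∧ b = x) ∧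
      ¬ (a = j ∧ b = i) := by
    intro a b hF
    refine ⟨?_, ?_, ?_⟩ <;> rintro ⟨rfl, rfl⟩ <;> contradiction
  have hjx := hcase i j hjF
  have hxx := hcase x i hxF
  unfold Near at hxi hij
  -- The red arc into `i` starts at `x`, and the one out of `i` ends at `j`. Both differ from `i`,
  -- and from each other since opposite red arcs are excluded, so they lie on opposite sides.
  obtain ⟨h1, h2⟩ | ⟨h1, h2⟩ : (i = x + 1 ∧ j = i + 1) ∨ (x = i + 1 ∧ i = j + 1) := by omega
  · refine lt_irrefl i (rbrPath_invariant (S := fun a => i < a) ?_ ?_ hp rfl rfl (.inl rfl)) <;>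
      intro a b hab
    · intro hF
      have := hcase a b hF
      unfold Near at hab
      omega
    · unfold Near at hab
      omega
  · refine lt_irrefl i (rbrPath_invariant (S := fun a => a < i) ?_ ?_ hp rfl rfl (.inl rfl)) <;>
      intro a b hab
    · intro hF
      have := hcase a b hF
      unfold Near at hab
      omega
    · unfold Near at hab
      omega

theorem onRedCircuit_of_locallyClosed {F : Set (PartitionDiagram n)} (h : LocallyClosed n F)
    (v : XiVertex n) : (Xi n F).OnRedCircuit v := by
  obtain ⟨i, hi, rfl⟩ := exists_eq_tauVertex v
  obtain ⟨j, hj, hij, h1, h2⟩ := h i hi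
  have r1 := (xi_red_iff hi hj).2 ⟨hij, h1⟩
  have r2 := (xi_red_iff hj hi).2 ⟨⟨hij.2, hij.1⟩, h2⟩
  refine ⟨([tauVertex i hi, tauVertex j hj] : List (XiVertex n)), by simp, ?_⟩
  rw [Cycle.chain_coe_cons]
  simp [r1, r2]

theorem transGen_of_isChain {V : Type*} {R : V → V → Prop} {v : V} (l : List V) (u : V)
    (h : List.IsChain R (u :: (l ++ [v]))) : Relation.TransGen R u v := by
  induction l generalizing u with
  | nil => simpa using Relation.TransGen.single (r := R) (by simpa using h)
  | cons w l ih =>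
    rw [List.cons_append, List.isChain_cons_cons] at h
    exact .head h.1 (ih w h.2)

/-- Blue loops inserted between consecutive red arcs make the circuit alternate. -/
theorem isRBRBase_of_onRedCircuit {V : Type*} {G : TwoColouredDigraph V} (hG : ∀ v, G.blue v v)
    {v : V} (h : G.OnRedCircuit v) : G.IsRBRBase v := by
  obtain ⟨c, hv, hc⟩ := h
  have : Relation.TransGen G.red v v := by
    induction c using Quotient.inductionOn with
    | _ l =>
      obtain ⟨s, t, rfl⟩ := List.append_of_mem (Cycle.mem_coe_iff.1 hv)
      have hrot : ((s ++ v :: t : List V) : Cycle V) = ((v :: (t ++ s) : List V) : Cycle V) :=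
        Cycle.coe_eq_coe.2 List.isRotated_append
      have hc' : Cycle.Chain G.red ((s ++ v :: t : List V) : Cycle V) := hc
      rw [hrot, Cycle.chain_coe_cons] at hc'
      exact transGen_of_isChain _ _ hc'
  have key : ∀ u, Relation.TransGen G.red u v → G.RBRPath u v := by
    intro u hu
    induction hu using Relation.TransGen.head_induction_on with
    | single h => exact .single h
    | head h _ ih => exact .cons h (hG _) ih
  exact key v this

/-! ### Generation by `F` and RBR circuits. -/

theorem hookProd_mul_mem_jones {k l : ℕ} (hk : k + 1 < n) (hl : l + 1 < n) {α : PartitionDiagram n}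
    (hα : α ∈ jones n) : hookProd n k l * α ∈ jones n := by
  refine hookProd_induction (P := fun k => hookProd n k l * α ∈ jones n) hl ?_ ?_ hk
  · rw [hookProd_self]
    exact tau_mul_mem_jones hα hl
  · intro i i' hi hi' hn ih
    rw [← tau_mul_hookProd hi hi' hl hn, mul_assoc']
    exact tau_mul_mem_jones ih hi

theorem closure_subset {F : Set (PartitionDiagram n)} (hF : F ⊆ subtopIdempotents n) :
    (Subsemigroup.closure F : Set (PartitionDiagram n)) ⊆ jones n \ {1} := by
  intro α hα
  -- Closure of the Jones monoid under products is available only for left factors built from `τᵢ`,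
  -- so it is carried through the induction. An upper hook survives right multiplication and
  -- excludes `1`.
  have key : (∀ β ∈ jones n, α * β ∈ jones n) ∧ α ∈ jones n ∧ ∃ i, α.UpperHook i := by
    refine Subsemigroup.closure_induction (p := fun α _ => (∀ β ∈ jones n, α * β ∈ jones n) ∧
      α ∈ jones n ∧ ∃ i, α.UpperHook i) (fun α h => ?_) (fun α β _ _ ih ih' => ?_) hα
    · obtain ⟨k, l, hk, hl, -, rfl⟩ := mem_subtopIdempotents_iff.1 (hF h)
      exact ⟨fun β hβ => hookProd_mul_mem_jones hk hl hβ, hookProd_mem_jones hk hl, k,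
        upperHook_hookProd hk hl⟩
    · refine ⟨fun γ hγ => ?_, ih.1 _ ih'.2.1, ih.2.2.imp fun i hi => hi.mul β⟩
      rw [mul_assoc']
      exact ih.1 _ (ih'.1 _ hγ)
  obtain ⟨i, hi⟩ := key.2.2
  exact ⟨key.2.1, hi.ne_one⟩

theorem hookProd_mem_closure_of_rbrPath {F : Set (PartitionDiagram n)} {u v : XiVertex n}
    (h : (Xi n F).RBRPath u v) {i j : ℕ} {hi : i + 1 < n} {hj : j + 1 < n}
    (hu : u = tauVertex i hi) (hv : v = tauVertex j hj) :
    hookProd n i j ∈ Subsemigroup.closure F := by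
  induction h generalizing i with
  | single h =>
    subst hu hv
    exact Subsemigroup.subset_closure ((xi_red_iff hi hj).1 h).2
  | @cons u w x v h h' p ih =>
    obtain ⟨c, hc, rfl⟩ := exists_eq_tauVertex w
    obtain ⟨d, hd, rfl⟩ := exists_eq_tauVertex x
    subst hu
    rw [← hookProd_mul_hookProd hi hc hd hj ((xi_blue_iff hc hd).1 h')]
    exact mul_mem (Subsemigroup.subset_closure ((xi_red_iff hi hc).1 h).2) (ih rfl hv)

theorem generatesSingularJones_of_isRBRBase {F : Set (PartitionDiagram n)}
    (hF : F ⊆ subtopIdempotents n) (h : ∀ v, (Xi n F).IsRBRBase v) :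
    GeneratesSingularJones F := by
  have htau : ∀ i, i + 1 < n → tau n i ∈ Subsemigroup.closure F := fun i hi =>
    hookProd_self n i ▸ hookProd_mem_closure_of_rbrPath (h (tauVertex i hi)) rfl rfl
  exact (closure_subset hF).antisymm fun α hα =>
    jones_induction htau (fun i _ hi _ _ ih => mul_mem (htau i hi) ih) hα.1 hα.2

theorem isRBRBase_of_generatesSingularJones {F : Set (PartitionDiagram n)}
    (hF : F ⊆ subtopIdempotents n) (h : GeneratesSingularJones F) (v : XiVertex n) :
    (Xi n F).IsRBRBase v := by
  -- Either the rank has dropped or the element comes from an RBR path. Left multiplication by an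
  -- arc of `F` prepends that arc to the path or drops the rank.
  let Good : PartitionDiagram n → Prop := fun α => α.rank + 2 < n ∨
    ∃ k l, ∃ hk : k + 1 < n, ∃ hl : l + 1 < n, α = hookProd n k l ∧
      (Xi n F).RBRPath (tauVertex k hk) (tauVertex l hl)
  have key : ∀ α ∈ Subsemigroup.closure F, Good α ∧ ∀ β, Good β → Good (α * β) := by
    intro α hα
    refine Subsemigroup.closure_induction (p := fun α _ => Good α ∧ ∀ β, Good β → Good (α * β))
      (fun α h => ?_) (fun α β _ _ ih ih' => ⟨ih.2 _ ih'.1, fun γ hγ => ?_⟩) hα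
    · obtain ⟨i, j, hi, hj, hij, rfl⟩ := mem_subtopIdempotents_iff.1 (hF h)
      have hred := (xi_red_iff hi hj).2 ⟨hij, h⟩
      refine ⟨.inr ⟨i, j, hi, hj, rfl, .single hred⟩, ?_⟩
      rintro β (hβ | ⟨k, l, hk, hl, rfl, hp⟩)
      · exact .inl (lt_of_le_of_lt (Nat.add_le_add_right (rank_mul_le _ _) 2) hβ)
      · by_cases hjk : Near j k
        · exact .inr ⟨i, l, hi, hl, hookProd_mul_hookProd hi hj hk hl hjk,
            .cons hred ((xi_blue_iff hj hk).2 hjk) hp⟩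
        · exact .inl (lt_of_le_of_lt (Nat.add_le_add_right (rank_hookProd_mul_le hi hj _) 2)
            (rank_tau_mul_hookProd_lt hj hk hl hjk))
    · rw [mul_assoc']
      exact ih.2 _ (ih'.2 _ hγ)
  obtain ⟨i, hi, rfl⟩ := exists_eq_tauVertex v
  have hmem : tau n i ∈ (Subsemigroup.closure F : Set (PartitionDiagram n)) := by
    rw [h]
    exact ⟨tau_mem_jones hi, (upperHook_tau hi).ne_one⟩
  rcases (key _ hmem).1 with hr | ⟨k, l, hk, hl, he, hp⟩
  · have := rank_tau hi
    omega
  · rw [← hookProd_self] at he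
    obtain ⟨rfl, rfl⟩ := hookProd_inj hi hi hk hl he
    exact hp

theorem xi_blue_self {F : Set (PartitionDiagram n)} (v : XiVertex n) : (Xi n F).blue v v := by
  obtain ⟨i, hi, rfl⟩ := exists_eq_tauVertex v
  exact (xi_blue_iff hi hi).2 (near_iff.2 (.inl rfl))

theorem generatesSingularJones_iff_locallyClosed {F : Set (PartitionDiagram n)}
    (hF : F ⊆ subtopIdempotents n) : GeneratesSingularJones F ↔ LocallyClosed n F :=
  ⟨fun h => locallyClosed_of_isRBRBase (isRBRBase_of_generatesSingularJones hF h), fun h =>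
    generatesSingularJones_of_isRBRBase hF fun v =>
      isRBRBase_of_onRedCircuit xi_blue_self (onRedCircuit_of_locallyClosed h v)⟩

theorem generatesSingularJones_tfae {F : Set (PartitionDiagram n)}
    (hF : F ⊆ subtopIdempotents n) :
    List.TFAE [GeneratesSingularJones F, ∀ v, (Xi n F).IsRBRBase v,
      ∀ v, (Xi n F).OnRedCircuit v] := by
  tfae_have 1 → 2 := isRBRBase_of_generatesSingularJones hF
  tfae_have 2 → 3 := fun h => onRedCircuit_of_locallyClosed (locallyClosed_of_isRBRBase h)
  tfae_have 3 → 1 := fun h =>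
    generatesSingularJones_of_isRBRBase hF fun v => isRBRBase_of_onRedCircuit xi_blue_self (h v)
  tfae_finish

/-! ### Counting the generating sets by a transfer matrix. -/

/-- Whether all vertices of a path with `m` edges are covered.  The entry `c i` records the two
arcs on edge `i` and the loop at its end; `t` tells whether the first vertex is covered by a loop
or by an edge before it. -/
def covered : (m : ℕ) → Bool → (Fin m → Bool × Bool × Bool) → Bool
  | 0, t, _ => t
  | m + 1, t, c => (t || ((c 0).1 && (c 0).2.1)) &&
      covered m (((c 0).1 && (c 0).2.1) || (c 0).2.2) (Fin.tail c)

/-- The number of configurations counted by `covered`. -/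
def coveredCount (m : ℕ) (t : Bool) : ℕ := ∑ c, if covered m t c then 1 else 0

theorem coveredCount_succ (m : ℕ) (t : Bool) :
    coveredCount (m + 1) t = ∑ d : Bool × Bool × Bool,
      if t || (d.1 && d.2.1) then coveredCount m ((d.1 && d.2.1) || d.2.2) else 0 := by
  unfold coveredCount
  rw [← (Fin.consEquiv fun _ : Fin (m + 1) => Bool × Bool × Bool).sum_comp,
    Fintype.sum_prod_type]
  refine Finset.sum_congr rfl fun d _ => ?_
  split_ifs with h
  · refine Finset.sum_congr rfl fun c _ => ?_
    simp only [Fin.consEquiv_apply, covered, Fin.cons_zero, h, Bool.true_and]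
    rfl
  · refine Finset.sum_eq_zero fun c _ => ?_
    simp [Fin.consEquiv_apply, covered, Fin.cons_zero, h]

/-- Of the eight states of an edge and the loop at its end, five cover the next vertex: two have
both arcs, three have the loop but not both arcs. If the first vertex is still uncovered, only the
two states with both arcs remain. -/
theorem coveredCount_succ_true (m : ℕ) :
    coveredCount (m + 1) true = 5 * coveredCount m true + 3 * coveredCount m false := by
  rw [coveredCount_succ]
  simp [Fintype.sum_prod_type]
  ring

theorem coveredCount_succ_false (m : ℕ) :
    coveredCount (m + 1) false = 2 * coveredCount m true := by
  rw [coveredCount_succ]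
  simp [Fintype.sum_prod_type]
  ring

theorem covered_iff (m : ℕ) (t : Bool) (a b l : ℕ → Bool) :
    covered m t (fun i => (a i, b i, l i)) ↔ (t ∨ (0 < m ∧ a 0 ∧ b 0)) ∧
      ∀ i < m, l i ∨ (a i ∧ b i) ∨ (i + 1 < m ∧ a (i + 1) ∧ b (i + 1)) := by
  induction m generalizing t a b l with
  | zero => simp [covered]
  | succ m ih =>
    have := ih ((a 0 && b 0) || l 0) (fun i => a (i + 1)) (fun i => b (i + 1)) fun i => l (i + 1)
    have htail : Fin.tail (fun i : Fin (m + 1) => (a i, b i, l i)) =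
        fun i : Fin m => (a (i + 1), b (i + 1), l (i + 1)) := by
      funext i
      simp [Fin.tail]
    rw [covered, htail, Bool.and_eq_true, Nat.forall_lt_succ_left]
    refine (and_congr_right' this).trans ?_
    simp
    tauto

theorem locallyClosed_iff (m : ℕ) (F : Set (PartitionDiagram (m + 2))) :
    LocallyClosed (m + 2) F ↔
      (hookProd (m + 2) 0 0 ∈ F ∨
        (0 < m ∧ hookProd (m + 2) 0 1 ∈ F ∧ hookProd (m + 2) 1 0 ∈ F)) ∧
      ∀ i < m, hookProd (m + 2) (i + 1) (i + 1) ∈ F ∨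
        (hookProd (m + 2) i (i + 1) ∈ F ∧ hookProd (m + 2) (i + 1) i ∈ F) ∨
        (i + 1 < m ∧ hookProd (m + 2) (i + 1) (i + 2) ∈ F ∧
          hookProd (m + 2) (i + 2) (i + 1) ∈ F) := by
  constructor
  · intro h
    refine ⟨?_, fun i hi => ?_⟩
    · obtain ⟨j, hj, hn, h1, h2⟩ := h 0 (by omega)
      obtain rfl | rfl | h' := near_iff.1 hn
      · exact .inl h1
      · exact .inr ⟨by omega, h1, h2⟩
      · omega
    · obtain ⟨j, hj, hn, h1, h2⟩ := h (i + 1) (by omega)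
      obtain rfl | rfl | h' := near_iff.1 hn
      · exact .inl h1
      · exact .inr (.inr ⟨by omega, h1, h2⟩)
      · obtain rfl : i = j := by omega
        exact .inr (.inl ⟨h2, h1⟩)
  · rintro ⟨h0, h⟩ (_ | i) hi
    · rcases h0 with h0 | ⟨hm, h1, h2⟩
      · exact ⟨0, hi, near_iff.2 (.inl rfl), h0, h0⟩
      · exact ⟨1, by omega, near_iff.2 (.inr (.inl rfl)), h1, h2⟩
    · rcases h i (by omega) with h0 | ⟨h1, h2⟩ | ⟨hm, h1, h2⟩
      · exact ⟨i + 1, hi, near_iff.2 (.inl rfl), h0, h0⟩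
      · exact ⟨i, by omega, near_iff.2 (.inr (.inr rfl)), h2, h1⟩
      · exact ⟨i + 2, by omega, near_iff.2 (.inr (.inl rfl)), h1, h2⟩

open scoped Classical in
/-- The red arcs given by `F`, listed along the path. -/
noncomputable def arcData (m : ℕ) (F : Set (PartitionDiagram (m + 2))) :
    Bool × (Fin m → Bool × Bool × Bool) :=
  (decide (hookProd (m + 2) 0 0 ∈ F), fun i => (decide (hookProd (m + 2) i (i + 1) ∈ F),
    decide (hookProd (m + 2) (i + 1) i ∈ F), decide (hookProd (m + 2) (i + 1) (i + 1) ∈ F)))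

/-- For `n = m + 2` the vertices form a path with `m` edges. The loop at vertex `0` is the initial
flag, and edge `i` carries the loop at `i + 1`. -/
theorem covered_arcData (m : ℕ) (F : Set (PartitionDiagram (m + 2))) :
    covered m (arcData m F).1 (arcData m F).2 ↔ LocallyClosed (m + 2) F := by
  classical
  rw [locallyClosed_iff]
  refine (covered_iff m _ (fun i => decide (hookProd (m + 2) i (i + 1) ∈ F))
    (fun i => decide (hookProd (m + 2) (i + 1) i ∈ F))
    (fun i => decide (hookProd (m + 2) (i + 1) (i + 1) ∈ F))).trans ?_
  simp [arcData]

theorem arcData_injOn (m : ℕ) : Set.InjOn (arcData m) {F | F ⊆ subtopIdempotents (m + 2)} := by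
  intro F hF G hG h
  simp only [arcData, Prod.mk.injEq, funext_iff, decide_eq_decide] at h
  obtain ⟨h0, h⟩ := h
  have key : ∀ k l, k + 1 < m + 2 → l + 1 < m + 2 → Near k l →
      (hookProd (m + 2) k l ∈ F ↔ hookProd (m + 2) k l ∈ G) := by
    intro k l hk hl hn
    obtain rfl | rfl | rfl := near_iff.1 hn
    · rcases k with _ | k
      · exact h0
      · exact (h ⟨k, by omega⟩).2.2
    · exact (h ⟨k, by omega⟩).1
    · exact (h ⟨l, by omega⟩).2.1
  ext α
  constructor <;> intro hα
  · obtain ⟨k, l, hk, hl, hn, rfl⟩ := mem_subtopIdempotents_iff.1 (hF hα)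
    exact (key k l hk hl hn).1 hα
  · obtain ⟨k, l, hk, hl, hn, rfl⟩ := mem_subtopIdempotents_iff.1 (hG hα)
    exact (key k l hk hl hn).2 hα

theorem arcData_surjective (m : ℕ) (p : Bool × (Fin m → Bool × Bool × Bool)) :
    ∃ F, F ⊆ subtopIdempotents (m + 2) ∧ arcData m F = p := by
  classical
  obtain ⟨t, c⟩ := p
  let R : ℕ → ℕ → Prop := fun k l => (k = 0 ∧ l = 0 ∧ t) ∨ ∃ i : Fin m,
    (k = i ∧ l = i + 1 ∧ (c i).1) ∨ (k = i + 1 ∧ l = i ∧ (c i).2.1) ∨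
      (k = i + 1 ∧ l = i + 1 ∧ (c i).2.2)
  let F : Set (PartitionDiagram (m + 2)) :=
    {α | ∃ k l, k + 1 < m + 2 ∧ l + 1 < m + 2 ∧ Near k l ∧ R k l ∧ α = hookProd (m + 2) k l}
  have hF : ∀ k l, k + 1 < m + 2 → l + 1 < m + 2 → Near k l →
      (hookProd (m + 2) k l ∈ F ↔ R k l) := by
    intro k l hk hl hn
    constructor
    · rintro ⟨k', l', hk', hl', -, hR, he⟩
      obtain ⟨rfl, rfl⟩ := hookProd_inj hk hl hk' hl' he
      exact hR
    · exact fun hR => ⟨k, l, hk, hl, hn, hR, rfl⟩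
  refine ⟨F, ?_, ?_⟩
  · rintro α ⟨k, l, hk, hl, hn, -, rfl⟩
    exact hookProd_mem_subtopIdempotents hk hl hn
  · refine Prod.ext ?_ (funext fun i => Prod.ext ?_ (Prod.ext ?_ ?_)) <;>
      simp only [arcData] <;> rw [Bool.eq_iff_iff, decide_eq_true_iff]
    · rw [hF 0 0 (by omega) (by omega) (near_iff.2 (.inl rfl))]
      simp [R]
    · rw [hF i (i + 1) (by omega) (by omega) (near_iff.2 (.inr (.inl rfl)))]
      refine ⟨?_, fun h => .inr ⟨i, .inl ⟨rfl, rfl, h⟩⟩⟩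
      rintro (⟨h, h', -⟩ | ⟨j, ⟨h, h', hc⟩ | ⟨h, h', hc⟩ | ⟨h, h', hc⟩⟩)
      · omega
      · rwa [Fin.ext h]
      · omega
      · omega
    · rw [hF (i + 1) i (by omega) (by omega) (near_iff.2 (.inr (.inr rfl)))]
      refine ⟨?_, fun h => .inr ⟨i, .inr (.inl ⟨rfl, rfl, h⟩)⟩⟩
      rintro (⟨h, h', -⟩ | ⟨j, ⟨h, h', hc⟩ | ⟨h, h', hc⟩ | ⟨h, h', hc⟩⟩)
      · omega
      · omega
      · rwa [Fin.ext h']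
      · omega
    · rw [hF (i + 1) (i + 1) (by omega) (by omega) (near_iff.2 (.inl rfl))]
      refine ⟨?_, fun h => .inr ⟨i, .inr (.inr ⟨rfl, rfl, h⟩)⟩⟩
      rintro (⟨h, h', -⟩ | ⟨j, ⟨h, h', hc⟩ | ⟨h, h', hc⟩ | ⟨h, h', hc⟩⟩)
      · omega
      · omega
      · omega
      · rwa [show i = j from Fin.ext (by omega)]

theorem numGeneratingSets_add_two (m : ℕ) :
    numGeneratingSets (m + 2) = coveredCount m true + coveredCount m false := by
  have hsum : coveredCount m true + coveredCount m false =
      (Finset.univ.filter fun p : Bool × (Fin m → Bool × Bool × Bool) => covered m p.1 p.2).card := by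
    rw [Finset.card_filter, Fintype.sum_prod_type]
    simp [coveredCount]
  rw [hsum, ← Set.ncard_coe_finset, numGeneratingSets]
  refine Set.ncard_congr (fun F _ => arcData m F) ?_ ?_ ?_
  · rintro F ⟨hF, hg⟩
    rw [Finset.mem_coe, Finset.mem_filter]
    exact ⟨Finset.mem_univ _,
      (covered_arcData m F).2 ((generatesSingularJones_iff_locallyClosed hF).1 hg)⟩
  · exact fun F G hF hG h => arcData_injOn m hF.1 hG.1 h
  · intro p hp
    rw [Finset.mem_coe, Finset.mem_filter] at hp
    obtain ⟨F, hF, rfl⟩ := arcData_surjective m p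
    exact ⟨F, ⟨hF, (generatesSingularJones_iff_locallyClosed hF).2
      ((covered_arcData m F).1 hp.2)⟩, rfl⟩

end PartitionDiagram

theorem mainTheorem6 :
    (∀ n : ℕ, 1 ≤ n → ∀ F : Set (PartitionDiagram n),
      F ⊆ PartitionDiagram.subtopIdempotents n →
        List.TFAE [
          PartitionDiagram.GeneratesSingularJones F,
          ∀ v : PartitionDiagram.XiVertex n, (PartitionDiagram.Xi n F).IsRBRBase v,
          ∀ v : PartitionDiagram.XiVertex n, (PartitionDiagram.Xi n F).OnRedCircuit v]) ∧
    PartitionDiagram.numGeneratingSets 2 = 1 ∧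
    PartitionDiagram.numGeneratingSets 3 = 7 ∧
    ∀ n : ℕ, 4 ≤ n →
      PartitionDiagram.numGeneratingSets n =
        5 * PartitionDiagram.numGeneratingSets (n - 1) +
          6 * PartitionDiagram.numGeneratingSets (n - 2) := by
  have hT : PartitionDiagram.coveredCount 0 true = 1 := by decide
  have hF : PartitionDiagram.coveredCount 0 false = 0 := by decide
  refine ⟨fun n _ F hF => PartitionDiagram.generatesSingularJones_tfae hF, ?_, ?_, fun n hn => ?_⟩
  · rw [PartitionDiagram.numGeneratingSets_add_two 0, hT, hF]
  · rw [PartitionDiagram.numGeneratingSets_add_two 1, PartitionDiagram.coveredCount_succ_true,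
      PartitionDiagram.coveredCount_succ_false, hT, hF]
  -- The transfer matrix with rows `(5, 3)` and `(2, 0)` has characteristic polynomial `x² - 5x -
  -- 6`, so both counts, and hence their sum, satisfy the recurrence.
  · obtain ⟨m, rfl⟩ := Nat.exists_eq_add_of_le' hn
    rw [show m + 4 - 1 = m + 1 + 2 by omega, show m + 4 - 2 = m + 2 by omega,
      show m + 4 = m + 2 + 2 by omega]
    simp only [PartitionDiagram.numGeneratingSets_add_two,
      PartitionDiagram.coveredCount_succ_true, PartitionDiagram.coveredCount_succ_false]
    ring
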